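/- **Setting.** Let $\{\xi(m)\}_{m\in\mathbb Z}$ and $\{\eta(m)\}_{m\in\mathbb Z}$ be uncorrelated, centred (wide-sense) stationary sequences of square-integrable complex random variables with spectral densities $f$ and $g$ on $[-\pi,\pi)$, so that $\mathsf E\,\xi(m)\overline{\xi(n)}=\frac1{2\pi}\int_{-\pi}^{\pi}e^{i(m-n)\lambda}f(\lambda)\,d\lambda$, and likewise for $\eta$ and $g$. Suppose $\int_{-\pi}^{\pi}\frac{d\lambda}{f(\lambda)+g(\lambda)}<\infty$, and that there are factorizations with $\psi,\theta,\phi\in\ell_2$: $$\frac1{f+g}=\Big|\sum_{k\ge0}\psi(k)e^{-i\lambda k}\Big|^2=\Big|\sum_{k\ge0}\theta(k)e^{-i\lambda k}\Big|^{-2},\qquad f=\Big|\sum_{k\ge0}\phi(k)e^{-i\lambda k}\Big|^2,$$ the first one being canonical, i.e. $\big(\sum_{k}\psi(k)e^{-i\lambda k}\big)\big(\sum_{k}\theta(k)e^{-i\lambda k}\big)=1$. Let $a=(a(k))_{k\ge0}$ be complex numbers with $\sum_k|a(k)|<\infty$ and $\sum_k(k+1)|a(k)|^2<\infty$, and put $A\xi=\sum_{k\ge0}a(k)\xi(-k)$.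 Let $\widehat A\xi$ be the mean-square optimal linear estimate of $A\xi$ from the observations $\xi(m)+\eta(m)$, $m\le0$: the element of the closed linear span of these observations at the least mean-square distance from $A\xi$. Its spectral characteristic is the function $h\in L_2(f+g)$ with $\widehat A\xi=\int h(\lambda)\,dZ_{\xi+\eta}(\lambda)$, where the stochastic integral is the continuous extension of $e^{im\lambda}\mapsto\xi(m)+\eta(m)$. For $n\in\mathbb Z$ let $f(n)$ and $s(n)$ be the Fourier coefficients $\frac1{2\pi}\int_{-\pi}^{\pi}(\cdot)\,e^{-in\lambda}d\lambda$ of $f$ and of $f/(f+g)$. Let $G=(f(l-k))_{l,k\ge0}$ and $T=(s(l-k))_{l,k\ge0}$; let $\Psi,\Theta,\Phi$ be the lower triangular matrices with entries $\psi(k-j),\theta(k-j),\phi(k-j)$ for $0\le j\le k$. A prime denotes transposition, a bar entrywise conjugation, $\langle x,y\rangle=\sum_kx_k\overline{y_k}$ and $\|x\|^2=\langle x,x\rangle$. Put $c=\overline G a$, let $C=(c(k+j))_{k,j\ge0}$, and let $z=\overline T\,\Theta a$. **Theorem.** 1. $z\in\ell_2$, and $z=\overline{(\Psi\Phi)}{}'\,\Phi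 a$. The spectral characteristic of the optimal estimate of $A\xi$ is (uniquely, up to equality almost everywhere) $$h(\lambda)=\Big(\sum_{k\ge0}\psi(k)e^{-i\lambda k}\Big)\sum_{m\ge0}z_m e^{-i\lambda m},$$ and the mean-square error is $\mathsf E|A\xi-\widehat A\xi|^2=\langle\overline G a,a\rangle-\|z\|^2$. 2. If $\overline Ga\in\ell_2$ (in particular, whenever $G$ is a bounded operator in $\ell_2$), then all series in $C\overline\psi$ converge absolutely, $C\overline\psi=\overline\Psi{}'\,\overline G a=z\in\ell_2$, and hence $$h(\lambda)=\Big(\sum_{k\ge0}\psi(k)e^{-i\lambda k}\Big)\sum_{m\ge0}(C\overline\psi)_m e^{-i\lambda m},\qquad \mathsf E|A\xi-\widehat A\xi|^2=\langle\overline G a,a\rangle-\|C\overline\psi\|^2 .$$ -/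

import Mathlib

open Real MeasureTheory Filter AddCircle
open scoped Matrix ComplexConjugate Topology ENNReal

noncomputable section

namespace Filtering

instance : Fact (0 < 2 * π) := ⟨Real.two_pi_pos⟩

/-- The frequency circle `[-π, π)`, written as `ℝ / 2πℤ`. -/
abbrev Circ : Type := AddCircle (2 * π)

/-- The measure `dλ / 2π` on the frequency circle. -/
abbrev dlam : Measure Circ := haarAddCircle

/-! ### Infinite matrices and vectors -/

/-- The matrix-vector product `(M v)_k = ∑_j M_{k,j} v_j`. -/
def mulVecInf (M : Matrix ℕ ℕ ℂ) (v : ℕ → ℂ) : ℕ → ℂ :=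
  fun k => ∑' j, M k j * v j

/-- The matrix product `(M N)_{i,j} = ∑_k M_{i,k} N_{k,j}`. -/
def mulInf (M N : Matrix ℕ ℕ ℂ) : Matrix ℕ ℕ ℂ :=
  Matrix.of fun i j => ∑' k, M i k * N k j

/-- The entrywise complex conjugate of a matrix. -/
def conjMat (M : Matrix ℕ ℕ ℂ) : Matrix ℕ ℕ ℂ := M.map conj

/-- The pairing `⟨x, y⟩ = ∑_k x_k conj(y_k)` of `ℓ₂`. -/
def pairing (x y : ℕ → ℂ) : ℂ := ∑' k, x k * conj (y k)

/-- The lower triangular matrix with entries `u(k - j)` for `j ≤ k` and `0` for `k < j`. -/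
def lowerMat (u : ℕ → ℂ) : Matrix ℕ ℕ ℂ :=
  Matrix.of fun k j => if j ≤ k then u (k - j) else 0

/-- The matrix with entries `F(l - k)`, `l, k ≥ 0`, where `F(n) = (1/2π) ∫ F(λ) e^{-inλ} dλ` are the
Fourier coefficients of the real function `F`. -/
def fourierMat (F : Circ → ℝ) : Matrix ℕ ℕ ℂ :=
  Matrix.of fun l k => fourierCoeff (fun t : Circ => (F t : ℂ)) ((l : ℤ) - (k : ℤ))

/-- The matrix with entries `c(k + j)`, `k, j ≥ 0`. -/
def hankelMat (c : ℕ → ℂ) : Matrix ℕ ℕ ℂ := Matrix.of fun k j => c (k + j)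

/-! ### One-sided Fourier series and factorizations -/

/-- The sum in `L₂` of `∑_{k ≥ 0} u(k) e^{-iλk}`; used for square summable `u`. -/
def series (u : ℕ → ℂ) : Lp ℂ 2 dlam :=
  ∑' k : ℕ, u k • (fourierLp 2 (-(k : ℤ)) : Lp ℂ 2 dlam)

/-- `f` is a spectral density: nonnegative and integrable. -/
structure IsDensity (f : Circ → ℝ) : Prop where
  nonneg : 0 ≤ᵐ[dlam] f
  integrable : Integrable f dlam

/-- The canonical factorization `1/F = |∑ ψ(k) e^{-iλk}|² = |∑ θ(k) e^{-iλk}|⁻²`, the two one-sided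
series being reciprocal to each other. -/
structure IsCanonicalFactorization (F : Circ → ℝ) (ψ θ : ℕ → ℂ) : Prop where
  memψ : Memℓp ψ 2
  memθ : Memℓp θ 2
  eqψ : ∀ᵐ t ∂dlam, (F t)⁻¹ = ‖series ψ t‖ ^ 2
  eqθ : ∀ᵐ t ∂dlam, (F t)⁻¹ = (‖series θ t‖ ^ 2)⁻¹
  recip : ∀ᵐ t ∂dlam, series ψ t * series θ t = 1

/-- The factorization `f = |∑ φ(k) e^{-iλk}|²` with a one-sided square summable `φ`. -/
structure IsOneSidedFactorization (f : Circ → ℝ) (φ : ℕ → ℂ) : Prop where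
  mem : Memℓp φ 2
  eq : ∀ᵐ t ∂dlam, f t = ‖series φ t‖ ^ 2

/-- The minimality condition `∫ 1 / F(λ) dλ < ∞`, where `1 / 0 = ∞`. -/
def Minimality (F : Circ → ℝ) : Prop :=
  ∫⁻ t, (ENNReal.ofReal (F t))⁻¹ ∂dlam < ∞

/-! ### Stationary sequences, their functionals and estimates -/

section

variable {Ω : Type*} [MeasurableSpace Ω] (P : Measure Ω)

/-- `ξ` is a centred (wide sense) stationary sequence of square integrable complex random variables
with spectral density `f`: `E ξ(m) conj(ξ(n)) = (1/2π) ∫ e^{i(m-n)λ} f(λ) dλ`. -/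
structure IsStationary (ξ : ℤ → Lp ℂ 2 P) (f : Circ → ℝ) : Prop where
  density : IsDensity f
  mean : ∀ m, ∫ ω, ξ m ω ∂P = 0
  cov : ∀ m n, ∫ ω, ξ m ω * conj (ξ n ω) ∂P = ∫ t, fourier (m - n) t * (f t : ℂ) ∂dlam

/-- The sequences `ξ` and `η` are uncorrelated. -/
def Uncorrelated (ξ η : ℤ → Lp ℂ 2 P) : Prop :=
  ∀ m n, ∫ ω, ξ m ω * conj (η n ω) ∂P = 0

variable {P}

/-- The functional `Aξ = ∑_{k ≥ 0} a(k) ξ(-k)`, a sum in mean square. -/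
def functional (a : ℕ → ℂ) (ξ : ℤ → Lp ℂ 2 P) : Lp ℂ 2 P :=
  ∑' k : ℕ, a k • ξ (-(k : ℤ))

/-- The closed linear subspace generated by `ζ(0), ζ(-1), ζ(-2), …`. -/
def pastSpace (ζ : ℤ → Lp ℂ 2 P) : Submodule ℂ (Lp ℂ 2 P) :=
  (Submodule.span ℂ (Set.range fun k : ℕ => ζ (-(k : ℤ)))).topologicalClosure

/-- `Y` is the mean-square optimal linear estimate of `X` from `ζ(0), ζ(-1), …`: it lies in the
closed subspace generated by the observations and has the least mean-square distance to `X`. -/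
def IsOptimalEstimate (ζ : ℤ → Lp ℂ 2 P) (X Y : Lp ℂ 2 P) : Prop :=
  Y ∈ pastSpace ζ ∧ ∀ Z ∈ pastSpace ζ, ‖X - Y‖ ≤ ‖X - Z‖

theorem existsUnique_isOptimalEstimate (ζ : ℤ → Lp ℂ 2 P) (X : Lp ℂ 2 P) :
    ∃! Y, IsOptimalEstimate ζ X Y := by
  have key : ∀ Y ∈ pastSpace ζ, IsOptimalEstimate ζ X Y ↔
      ∀ w ∈ pastSpace ζ, inner ℂ (X - Y) w = 0 := by
    intro Y hY
    rw [← Submodule.norm_eq_iInf_iff_inner_eq_zero (pastSpace ζ) hY]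
    constructor
    · intro h
      refine le_antisymm (le_ciInf fun w => h.2 w w.2) ?_
      exact ciInf_le (f := fun w : pastSpace ζ => ‖X - w‖)
        ⟨0, by rintro _ ⟨w, rfl⟩; exact norm_nonneg _⟩ ⟨Y, hY⟩
    · intro h
      refine ⟨hY, fun Z hZ => h.trans_le ?_⟩
      exact ciInf_le (f := fun w : pastSpace ζ => ‖X - w‖)
        ⟨0, by rintro _ ⟨w, rfl⟩; exact norm_nonneg _⟩ ⟨Z, hZ⟩
  have : CompleteSpace (pastSpace ζ) :=
    (Submodule.isClosed_topologicalClosure _).completeSpace_coe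
  refine ⟨(pastSpace ζ).starProjection X, ?_, ?_⟩
  · refine (key _ (Submodule.starProjection_apply_mem _ _)).2 fun w hw => ?_
    exact Submodule.starProjection_inner_eq_zero X w hw
  · intro Y hY
    exact (Submodule.eq_starProjection_of_mem_of_inner_eq_zero hY.1 ((key Y hY.1).1 hY)).symm

/-- The mean-square error `E |X - Y|²`. -/
def meanSquareError (X Y : Lp ℂ 2 P) : ℝ := ∫ ω, ‖(X - Y : Lp ℂ 2 P) ω‖ ^ 2 ∂P

/-- The spectral measure `F(λ) dλ / 2π`. -/
def spectralMeasure (F : Circ → ℝ) : Measure Circ :=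
  dlam.withDensity fun t => ENNReal.ofReal (F t)

/-- `Y = ∫ h(λ) dZ_ζ(λ)` for a stationary sequence `ζ` with spectral density `F`: the stochastic
integral is the continuous extension to `L₂(F)` of the map that sends a trigonometric
polynomial `∑ p(k) e^{ikλ}` to `∑ p(k) ζ(k)`. -/
def IsSpectralIntegral (F : Circ → ℝ) (ζ : ℤ → Lp ℂ 2 P) (h : Circ → ℂ) (Y : Lp ℂ 2 P) : Prop :=
  MemLp h 2 (spectralMeasure F) ∧
    ∃ p : ℕ → ℤ →₀ ℂ,
      Tendsto (fun n => eLpNorm (fun t => h t - (p n).sum fun k c => c * fourier k t) 2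
        (spectralMeasure F)) atTop (𝓝 0) ∧
      Tendsto (fun n => (p n).sum fun k c => c • ζ k) atTop (𝓝 Y)

end

end Filtering

end

/-! Write `w` for the series of `θ`, so that `|w|² = f + g`. Since `ξ(n) + η(n)` and `w e^{inλ}`
have the same Gram matrix, the observations can be replaced by the functions `w e^{-ikλ}`, `k ≥ 0`,
in `L₂`. Let `A` be the series of `a` and `b = f · conj ψ · A`, with `ψ` standing for its series.
From `f|ψ|² = f/(f+g) ≤ 1` one gets `|f ψ|² ≤ f`, and `A` is bounded, so `b` is square integrable.
As `ψ w = 1`, the product of `Aξ` with the observation at `-k` is the `k`-th moment of `f A = b ·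
conj w`. For `k ≥ 0` this involves only the moments of `b` of nonnegative order, so `b` may be
replaced by its one-sided part. The coefficients of that part are `z`: both `s · wA` and `conj(ψφ) ·
φA` equal `b`.

If the series of `z` lies in the closed span of `w e^{-ikλ}`, it therefore represents the projection
of `Aξ`. Dividing by `w`, that is, multiplying by `ψ`, gives the spectral characteristic, and
Pythagoras gives the error. The membership holds because `w` is outer (`series_mem_shiftSpan`).

The analytic core is `moment_mul_series_eq_zero`, a Smirnov-type principle: an `H¹` function
vanishing at the origin, times an `H²` function, is again such a function as soon as the product is
integrable. It is proved without inner-outer factorization: `exists_innovation`, Szegő's prediction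
argument, produces the multipliers of `exists_multiplier` that regularize the product. The same
principle gives `C conj(ψ) = z` when `c` is square summable, although `f A` itself is known only to
be integrable.

The moment of order `n` is the Fourier coefficient of order `-n`, so that the series in `e^{-iλk}`
have moments supported on `n ≥ 0`. -/

namespace Filtering

/-! ### Moments of functions on the circle -/

/-- The moment `∫ u(λ) e^{inλ} dλ / 2π`. -/
noncomputable def moment (u : Circ → ℂ) (n : ℤ) : ℂ := ∫ t, u t * fourier n t ∂dlam

theorem norm_fourier_apply (n : ℤ) (t : Circ) : ‖fourier n t‖ = 1 := by
  rw [fourier_apply]; exact Circle.norm_coe _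

theorem moment_congr {u v : Circ → ℂ} (h : u =ᵐ[dlam] v) (n : ℤ) : moment u n = moment v n :=
  integral_congr_ae (h.mono fun t ht => by simp only [ht])

theorem moment_mul_fourier (u : Circ → ℂ) (m n : ℤ) :
    moment (fun t => u t * fourier m t) n = moment u (m + n) := by
  simp only [moment, fourier_add, mul_assoc]

theorem moment_conj (u : Circ → ℂ) (n : ℤ) :
    moment (fun t => conj (u t)) n = conj (moment u (-n)) := by
  simp only [moment, ← integral_conj, map_mul, ← fourier_neg, neg_neg]

theorem integrable_mul_fourier {u : Circ → ℂ} (hu : Integrable u dlam) (n : ℤ) :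
    Integrable (fun t => u t * fourier n t) dlam :=
  hu.mul_bdd (c := 1) (fourier n).continuous.aestronglyMeasurable
    (ae_of_all _ fun t => (norm_fourier_apply n t).le)

theorem memLp_mul_fourier {u : Circ → ℂ} {p : ℝ≥0∞} (hu : MemLp u p dlam) (n : ℤ) :
    MemLp (fun t => u t * fourier n t) p dlam :=
  hu.of_le (hu.1.mul (fourier n).continuous.aestronglyMeasurable)
    (ae_of_all _ fun t => by rw [norm_mul, norm_fourier_apply, mul_one])

theorem memLp_conj {u : Circ → ℂ} {p : ℝ≥0∞} (hu : MemLp u p dlam) :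
    MemLp (fun t => conj (u t)) p dlam :=
  hu.star

theorem moment_sub {u v : Circ → ℂ} (hu : Integrable u dlam) (hv : Integrable v dlam) (n : ℤ) :
    moment (fun t => u t - v t) n = moment u n - moment v n := by
  simp only [moment, sub_mul]
  exact integral_sub (integrable_mul_fourier hu n) (integrable_mul_fourier hv n)

theorem moment_fourier (m n : ℤ) : moment (fourier m) n = if m + n = 0 then 1 else 0 := by
  have h := congrFun (fourierCoeff_fourier (T := 2 * π) m) (-n)
  simp only [fourierCoeff, neg_neg, smul_eq_mul] at h
  simp only [moment, mul_comm (fourier m _)]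
  rw [h, Pi.single_apply]
  simp only [neg_eq_iff_add_eq_zero, add_comm]

/-- An integrable function with vanishing moments is zero almost everywhere. -/
theorem ae_eq_zero_of_moment_eq_zero {v : Circ → ℂ} (hv : Integrable v dlam)
    (h : ∀ n, moment v n = 0) : v =ᵐ[dlam] 0 := by
  have hint : ∀ x : C(Circ, ℂ), Integrable (fun t => v t * x t) dlam := fun x =>
    hv.mul_bdd (c := ‖x‖) x.continuous.aestronglyMeasurable (ae_of_all _ x.norm_coe_le_norm)
  let Λ : C(Circ, ℂ) →L[ℂ] ℂ := LinearMap.mkContinuous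
    { toFun := fun x => ∫ t, v t * x t ∂dlam
      map_add' := fun x y => by
        simp only [ContinuousMap.add_apply, mul_add]
        exact integral_add (hint x) (hint y)
      map_smul' := fun c x => by
        simp only [ContinuousMap.smul_apply, smul_eq_mul, mul_left_comm _ c, RingHom.id_apply]
        exact integral_const_mul c _ } (∫ t, ‖v t‖ ∂dlam) fun x => by
      refine (norm_integral_le_integral_norm _).trans ?_
      rw [← integral_mul_const]
      refine integral_mono (hint x).norm (hv.norm.mul_const _) fun t => ?_
      simpa using mul_le_mul_of_nonneg_left (x.norm_coe_le_norm t) (norm_nonneg _)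
  have hΛ : ∀ x, Λ x = 0 := by
    have : (Submodule.span ℂ (Set.range (@fourier (2 * π)))).topologicalClosure ≤
        LinearMap.ker Λ.toLinearMap := by
      refine Submodule.topologicalClosure_minimal _ (Submodule.span_le.2 ?_)
        (Λ.isClosed_ker)
      rintro _ ⟨n, rfl⟩
      exact h n
    rw [span_fourier_closure_eq_top] at this
    exact fun x => this trivial
  -- The functional kills trigonometric polynomials, hence all continuous functions. Indicators of
  -- closed sets are bounded pointwise limits of continuous functions, with `‖v‖` as dominating
  -- function.
  refine ae_eq_zero_of_forall_setIntegral_isClosed_eq_zero hv fun s hs => ?_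
  have hlim : Tendsto (fun n => ∫ t, v t * ((hs.apprSeq n t : ℝ) : ℂ) ∂dlam) atTop
      (𝓝 (∫ t, s.indicator v t ∂dlam)) := by
    refine tendsto_integral_of_dominated_convergence (fun t => ‖v t‖) (fun n => ?_) hv.norm
      (fun n => ae_of_all _ fun t => ?_) (ae_of_all _ fun t => ?_)
    · refine hv.1.mul (Continuous.aestronglyMeasurable ?_)
      have := (hs.apprSeq n).continuous
      fun_prop
    · rw [norm_mul]
      have : (hs.apprSeq n t : ℝ) ≤ 1 := by exact_mod_cast HasOuterApproxClosed.apprSeq_apply_le_one hs n t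
      simpa using mul_le_mul_of_nonneg_left this (norm_nonneg (v t))
    · have h1 := (tendsto_pi_nhds.1 (HasOuterApproxClosed.tendsto_apprSeq hs) t)
      by_cases hts : t ∈ s
      · simp only [hts, Set.indicator_of_mem] at h1 ⊢
        have h2 := (Complex.continuous_ofReal.tendsto _).comp (NNReal.tendsto_coe.2 h1)
        simpa using h2.const_mul (v t)
      · simp only [hts, Set.indicator_of_notMem, not_false_eq_true] at h1 ⊢
        have h2 := (Complex.continuous_ofReal.tendsto _).comp (NNReal.tendsto_coe.2 h1)
        simpa using h2.const_mul (v t)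
  rw [integral_indicator hs.measurableSet] at hlim
  refine tendsto_nhds_unique hlim ?_
  have : ∀ n, ∫ t, v t * ((hs.apprSeq n t : ℝ) : ℂ) ∂dlam = 0 := fun n =>
    hΛ ⟨fun t => ((hs.apprSeq n t : ℝ) : ℂ), by
      have := (hs.apprSeq n).continuous
      fun_prop⟩
  simp only [this]
  exact tendsto_const_nhds

/-! ### The bilinear pairing of square integrable functions -/

/-- The functional `u ↦ ∫ u(λ) w(λ) dλ / 2π`. -/
noncomputable def pairL {w : Circ → ℂ} (hw : MemLp w 2 dlam) : Lp ℂ 2 dlam →L[ℂ] ℂ :=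
  innerSL ℂ (hw.star.toLp _)

theorem pairL_apply {w : Circ → ℂ} (hw : MemLp w 2 dlam) (u : Lp ℂ 2 dlam) :
    pairL hw u = ∫ t, u t * w t ∂dlam := by
  rw [pairL, innerSL_apply_apply, L2.inner_def]
  refine integral_congr_ae (hw.star.coeFn_toLp.mono fun t ht => ?_)
  simp only [ht, RCLike.inner_apply]
  simp

theorem integral_mul_eq_zero_of_mem_topologicalClosure {s : Set (Lp ℂ 2 dlam)} {w : Circ → ℂ}
    (hw : MemLp w 2 dlam) (h : ∀ u ∈ s, ∫ t, u t * w t ∂dlam = 0) {u : Lp ℂ 2 dlam}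
    (hu : u ∈ (Submodule.span ℂ s).topologicalClosure) : ∫ t, u t * w t ∂dlam = 0 := by
  have : (Submodule.span ℂ s).topologicalClosure ≤ LinearMap.ker (pairL hw).toLinearMap :=
    Submodule.topologicalClosure_minimal _
      (Submodule.span_le.2 fun u hu => (pairL_apply hw u).trans (h u hu)) (pairL hw).isClosed_ker
  exact (pairL_apply hw u).symm.trans (this hu)

/-! ### One-sided series -/

theorem orthonormal_fourierLp_neg :
    Orthonormal ℂ fun k : ℕ => (fourierLp 2 (-(k : ℤ)) : Lp ℂ 2 dlam) :=
  orthonormal_fourier.comp _ fun i j h => by simpa using h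

theorem memℓp_two_iff {y : ℕ → ℂ} : Memℓp y 2 ↔ Summable fun k => ‖y k‖ ^ 2 := by
  rw [memℓp_gen_iff (by simp)]
  simp

theorem hasSum_series {y : ℕ → ℂ} (hy : Memℓp y 2) :
    HasSum (fun k : ℕ => y k • (fourierLp 2 (-(k : ℤ)) : Lp ℂ 2 dlam)) (series y) := by
  have := (orthonormal_fourierLp_neg.orthogonalFamily.summable_iff_norm_sq_summable y).2
    (memℓp_two_iff.1 hy)
  simpa [series] using this.hasSum

theorem memLp_series (y : ℕ → ℂ) : MemLp (series y) 2 dlam := Lp.memLp _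

theorem integrable_series (y : ℕ → ℂ) : Integrable (series y) dlam :=
  (memLp_series y).integrable (by norm_num)

/-- The `L₂` sum defining the series passes through a continuous functional. The moment formulas for
products below are instances with a suitable `w`. -/
theorem hasSum_mul_moment {y : ℕ → ℂ} (hy : Memℓp y 2) {w : Circ → ℂ} (hw : MemLp w 2 dlam) :
    HasSum (fun k : ℕ => y k * moment w (-(k : ℤ))) (∫ t, series y t * w t ∂dlam) := by
  have := (hasSum_series hy).mapL (pairL hw)
  simp only [map_smul, pairL_apply, smul_eq_mul] at this
  convert this using 2 with k
  exact congrArg _ (integral_congr_ae ((coeFn_fourierLp 2 (-(k : ℤ))).mono fun t ht => by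
    simp only [ht, mul_comm]))

theorem hasSum_mul_moment_series {y : ℕ → ℂ} (hy : Memℓp y 2) (n : ℤ) :
    HasSum (fun k : ℕ => if n = k then y k else 0) (moment (series y) n) := by
  have hw : MemLp (fourier n : Circ → ℂ) 2 dlam :=
    (memLp_mul_fourier (u := fun _ => 1) (memLp_const 1) n).ae_eq (by simp; rfl)
  refine (hasSum_mul_moment hy hw).congr_fun fun k => ?_
  rw [moment_fourier]
  simp [← sub_eq_add_neg, sub_eq_zero]

theorem moment_series {y : ℕ → ℂ} (hy : Memℓp y 2) (k : ℕ) : moment (series y) k = y k := by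
  refine (hasSum_mul_moment_series hy k).unique ?_
  convert hasSum_ite_eq k (y k) using 2 with j
  by_cases h : j = k
  · simp [h]
  · simp [h, Ne.symm h]

theorem moment_series_of_neg {y : ℕ → ℂ} (hy : Memℓp y 2) {n : ℤ} (hn : n < 0) :
    moment (series y) n = 0 := by
  refine (hasSum_mul_moment_series hy n).unique ?_
  have : ∀ k : ℕ, n ≠ k := fun k => by omega
  simp [this]

theorem moment_series_sub {y : ℕ → ℂ} (hy : Memℓp y 2) (k j : ℕ) :
    moment (series y) ((k : ℤ) - j) = lowerMat y k j := by
  rw [lowerMat, Matrix.of_apply]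
  split_ifs with h
  · rw [← moment_series hy, Nat.cast_sub h]
  · exact moment_series_of_neg hy (by omega)

theorem fourierCoeff_toLp_eq_moment {u : Circ → ℂ} (hu : MemLp u 2 dlam) (n : ℤ) :
    fourierCoeff (hu.toLp u) n = moment u (-n) := by
  rw [← moment_congr hu.coeFn_toLp]
  simp only [fourierCoeff, moment, smul_eq_mul, mul_comm]

theorem neg_natCast_injective : Function.Injective fun k : ℕ => -(k : ℤ) :=
  fun i j h => by simpa using h

theorem memℓp_moment {u : Circ → ℂ} (hu : MemLp u 2 dlam) :
    Memℓp (fun k : ℕ => moment u k) 2 := by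
  rw [memℓp_two_iff]
  have := (hasSum_sq_fourierCoeff (hu.toLp u)).summable.comp_injective neg_natCast_injective
  simpa [Function.comp_def, fourierCoeff_toLp_eq_moment hu] using this

/-- A square integrable function whose moments of negative order vanish is the one-sided series of
its moments. -/
theorem series_moment {u : Circ → ℂ} (hu : MemLp u 2 dlam) (h : ∀ n < 0, moment u n = 0) :
    series (fun k : ℕ => moment u k) =ᵐ[dlam] u := by
  have hs := hasSum_fourier_series_L2 (hu.toLp u)
  rw [← neg_natCast_injective.hasSum_iff] at hs
  · simp only [Function.comp_def, fourierCoeff_toLp_eq_moment hu, neg_neg] at hs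
    rw [series, hs.tsum_eq]
    exact hu.coeFn_toLp
  · intro n hn
    rw [fourierCoeff_toLp_eq_moment hu, h, zero_smul]
    by_contra! hn'
    exact hn ⟨n.natAbs, by dsimp only; omega⟩

/-- The moments of a product of two one-sided series. -/
theorem hasSum_moment_series_mul {x y : ℕ → ℂ} (hy : Memℓp y 2) (n : ℤ) :
    HasSum (fun j : ℕ => moment (series x) (n - j) * y j)
      (moment (fun t => series x t * series y t) n) := by
  have := hasSum_mul_moment hy (memLp_mul_fourier (memLp_series x) n)
  simp only [moment_mul_fourier, ← sub_eq_add_neg] at this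
  simpa only [moment, mul_comm, mul_left_comm, mul_assoc] using this

theorem moment_series_mul {x y : ℕ → ℂ} (hx : Memℓp x 2) (hy : Memℓp y 2) (k : ℕ) :
    moment (fun t => series x t * series y t) k = mulVecInf (lowerMat x) y k := by
  rw [← (hasSum_moment_series_mul hy k).tsum_eq, mulVecInf]
  simp only [moment_series_sub hx]

theorem moment_series_mul_of_neg {x y : ℕ → ℂ} (hx : Memℓp x 2) (hy : Memℓp y 2) {n : ℤ}
    (hn : n < 0) : moment (fun t => series x t * series y t) n = 0 := by
  rw [← (hasSum_moment_series_mul hy n).tsum_eq]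
  have : ∀ j : ℕ, moment (series x) (n - j) = 0 := fun j => moment_series_of_neg hx (by omega)
  simp [this]

theorem series_mulVecInf_lowerMat {x y : ℕ → ℂ} (hx : Memℓp x 2) (hy : Memℓp y 2)
    (h : MemLp (fun t => series x t * series y t) 2 dlam) :
    Memℓp (mulVecInf (lowerMat x) y) 2 ∧
      series (mulVecInf (lowerMat x) y) =ᵐ[dlam] fun t => series x t * series y t := by
  have := And.intro (memℓp_moment h)
    (series_moment h fun n hn => moment_series_mul_of_neg hx hy hn)
  simpa only [moment_series_mul hx hy] using this

/-- The moments of the product of a function with a conjugated one-sided series. -/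
theorem hasSum_moment_mul_conj_series {y : ℕ → ℂ} (hy : Memℓp y 2) {u : Circ → ℂ}
    (hu : MemLp u 2 dlam) (n : ℤ) :
    HasSum (fun j : ℕ => moment u (n + j) * conj (y j))
      (moment (fun t => u t * conj (series y t)) n) := by
  have h := (hasSum_mul_moment hy (memLp_mul_fourier (memLp_conj hu) (-n))).star
  simp only [moment_mul_fourier, moment_conj, ← neg_add, neg_neg,
    ← starRingEnd_apply, Complex.conj_conj, ← integral_conj, map_mul, ← fourier_neg] at h
  simpa only [moment, mul_comm, mul_left_comm, mul_assoc] using h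

theorem tsum_ite_le (k : ℕ) (g : ℕ → ℂ) :
    ∑' i, (if k ≤ i then g i else 0) = ∑' j, g (k + j) := by
  rw [← (add_right_injective k).tsum_eq (f := fun i => if k ≤ i then g i else 0)]
  · simp
  · intro i hi
    obtain ⟨j, rfl⟩ := Nat.exists_eq_add_of_le (by
      by_contra h
      simp [h] at hi : k ≤ i)
    exact ⟨j, rfl⟩

/-- Only a reindexing of `tsum` along an injection, so no summability is needed. It also identifies
the Hankel product `C conj(ψ)` with `Ψᴴ c`. -/
theorem mulVecInf_lowerMat_conjTranspose_apply (x y : ℕ → ℂ) (k : ℕ) :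
    mulVecInf (lowerMat x)ᴴ y k = ∑' j, y (k + j) * conj (x j) := by
  have := tsum_ite_le k fun i => y i * conj (x (i - k))
  simp only [Nat.add_sub_cancel_left] at this
  rw [← this, mulVecInf]
  refine tsum_congr fun i => ?_
  rw [Matrix.conjTranspose_apply, lowerMat, Matrix.of_apply]
  split_ifs <;> simp [mul_comm]

theorem mulVecInf_lowerMat_conjTranspose {x y : ℕ → ℂ} (hx : Memℓp x 2) (hy : Memℓp y 2) (k : ℕ) :
    mulVecInf (lowerMat x)ᴴ y k = moment (fun t => series y t * conj (series x t)) k := by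
  rw [← (hasSum_moment_mul_conj_series hx (memLp_series y) k).tsum_eq,
    mulVecInf_lowerMat_conjTranspose_apply]
  simp only [← Nat.cast_add, moment_series hy]

/-- The product of lower triangular Toeplitz matrices. -/
theorem mulInf_lowerMat (x y : ℕ → ℂ) :
    mulInf (lowerMat x) (lowerMat y) = lowerMat (mulVecInf (lowerMat x) y) := by
  ext i j
  have h := tsum_ite_le j fun k => lowerMat x i k * y (k - j)
  simp only [Nat.add_sub_cancel_left] at h
  have h1 : mulInf (lowerMat x) (lowerMat y) i j = ∑' l, lowerMat x i (j + l) * y l := by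
    rw [← h, mulInf, Matrix.of_apply]
    refine tsum_congr fun k => ?_
    simp only [lowerMat, Matrix.of_apply]
    split_ifs <;> simp
  rw [h1, lowerMat, lowerMat, Matrix.of_apply]
  split_ifs with hij
  · refine tsum_congr fun l => ?_
    simp only [Matrix.of_apply, Nat.le_sub_iff_add_le' hij, Nat.sub_sub]
  · have : ∀ l, ¬ j + l ≤ i := fun l => by omega
    simp [this]

/-! ### Absolutely summable coefficients -/

theorem memℓp_two_of_summable_norm {a : ℕ → ℂ} (ha : Summable fun k => ‖a k‖) : Memℓp a 2 := by
  have : Memℓp a 1 := (memℓp_gen_iff (by simp)).2 (by simpa using ha)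
  exact this.of_exponent_ge (by norm_num)

theorem exists_continuousMap_series {a : ℕ → ℂ} (ha : Summable fun k => ‖a k‖) :
    ∃ A : C(Circ, ℂ), series a =ᵐ[dlam] A ∧
      HasSum (fun k : ℕ => a k • (fourier (-(k : ℤ)) : C(Circ, ℂ))) A := by
  have hs : Summable fun k : ℕ => a k • (fourier (-(k : ℤ)) : C(Circ, ℂ)) :=
    Summable.of_norm (by simpa [norm_smul, fourier_norm] using ha)
  refine ⟨_, ?_, hs.hasSum⟩
  have := hs.hasSum.mapL (ContinuousMap.toLp 2 dlam ℂ)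
  simp only [map_smul] at this
  rw [show series a = _ from this.tsum_eq]
  exact ContinuousMap.coeFn_toLp _ _

theorem exists_norm_series_le {a : ℕ → ℂ} (ha : Summable fun k => ‖a k‖) :
    ∃ C : ℝ, ∀ᵐ t ∂dlam, ‖series a t‖ ≤ C := by
  obtain ⟨A, hA, -⟩ := exists_continuousMap_series ha
  exact ⟨‖A‖, hA.mono fun t ht => ht ▸ A.norm_coe_le_norm t⟩

/-- Counterpart of `hasSum_mul_moment` for `w` merely integrable, as a spectral density is; absolute
summability of `a` pays for termwise integration. -/
theorem hasSum_mul_moment_of_summable_norm {a : ℕ → ℂ} (ha : Summable fun k => ‖a k‖)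
    {w : Circ → ℂ} (hw : Integrable w dlam) :
    HasSum (fun k : ℕ => a k * moment w (-(k : ℤ))) (∫ t, series a t * w t ∂dlam) := by
  obtain ⟨A, hA, hs⟩ := exists_continuousMap_series ha
  have h := hasSum_integral_of_summable_integral_norm (μ := dlam)
    (F := fun (k : ℕ) t => a k * (w t * fourier (-(k : ℤ)) t))
    (fun k => (integrable_mul_fourier hw _).const_mul _) ?_
  · simp only [integral_const_mul] at h
    refine (Eq.subst (motive := HasSum _) ?_ h :)
    refine integral_congr_ae (hA.mono fun t ht => ?_)
    simp only [ht]
    have h2 := (hs.mapL (ContinuousMap.evalCLM ℂ t)).mul_right (w t)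
    simp only [ContinuousMap.evalCLM_apply, ContinuousMap.smul_apply, smul_eq_mul] at h2
    rw [← h2.tsum_eq]
    simp only [mul_comm, mul_left_comm]
  · simp only [norm_mul, norm_fourier_apply, mul_one, integral_const_mul]
    exact ha.mul_right _


theorem norm_sq_eq_integral {Ω : Type*} [MeasurableSpace Ω] {P : Measure Ω} (u : Lp ℂ 2 P) :
    ‖u‖ ^ 2 = ∫ t, ‖u t‖ ^ 2 ∂P := by
  have h2 : ((∫ t, ‖u t‖ ^ 2 ∂P : ℝ) : ℂ) = ((‖u‖ ^ 2 : ℝ) : ℂ) := by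
    rw [← integral_complex_ofReal]
    push_cast
    refine Eq.trans ?_ (inner_self_eq_norm_sq_to_K (𝕜 := ℂ) u)
    rw [L2.inner_def]
    exact integral_congr_ae (ae_of_all _ fun t => (inner_self_eq_norm_sq_to_K (𝕜 := ℂ) (u t)).symm)
  exact_mod_cast h2.symm

/-! ### Shifts of a square integrable function and bounded multipliers -/

/-- The function `w(λ) e^{inλ}` as an element of `L₂`. -/
noncomputable def shift {w : Circ → ℂ} (hw : MemLp w 2 dlam) (n : ℤ) : Lp ℂ 2 dlam :=
  (memLp_mul_fourier hw n).toLp _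

theorem coeFn_shift {w : Circ → ℂ} (hw : MemLp w 2 dlam) (n : ℤ) :
    shift hw n =ᵐ[dlam] fun t => w t * fourier n t :=
  MemLp.coeFn_toLp _

theorem inner_shift {w : Circ → ℂ} (hw : MemLp w 2 dlam) (n : ℤ) (u : Lp ℂ 2 dlam) :
    inner ℂ (shift hw n) u = moment (fun t => u t * conj (w t)) (-n) := by
  rw [L2.inner_def]
  refine integral_congr_ae ((coeFn_shift hw n).mono fun t ht => ?_)
  simp only [ht, RCLike.inner_apply, map_mul, fourier_neg]
  ring

theorem integral_shift_mul {w : Circ → ℂ} (hw : MemLp w 2 dlam) (n : ℤ) (v : Circ → ℂ) :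
    ∫ t, shift hw n t * v t ∂dlam = moment (fun t => w t * v t) n :=
  integral_congr_ae ((coeFn_shift hw n).mono fun t ht => by simp only [ht]; ring)

/-- The closed span of the functions `w(λ) e^{-inλ}`, `n ≥ 0`. -/
noncomputable def shiftSpan {w : Circ → ℂ} (hw : MemLp w 2 dlam) : Submodule ℂ (Lp ℂ 2 dlam) :=
  (Submodule.span ℂ (Set.range fun k : ℕ => shift hw (-(k : ℤ)))).topologicalClosure

theorem isClosed_shiftSpan {w : Circ → ℂ} (hw : MemLp w 2 dlam) :
    IsClosed (shiftSpan hw : Set (Lp ℂ 2 dlam)) :=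
  Submodule.isClosed_topologicalClosure _

instance {w : Circ → ℂ} (hw : MemLp w 2 dlam) : CompleteSpace (shiftSpan hw) :=
  (isClosed_shiftSpan hw).completeSpace_coe

theorem shift_mem_shiftSpan {w : Circ → ℂ} (hw : MemLp w 2 dlam) (k : ℕ) :
    shift hw (-(k : ℤ)) ∈ shiftSpan hw :=
  Submodule.le_topologicalClosure _ (Submodule.subset_span ⟨k, rfl⟩)

theorem integral_mul_eq_zero_of_mem_shiftSpan {w v : Circ → ℂ} (hw : MemLp w 2 dlam)
    (hv : MemLp v 2 dlam) (h : ∀ k : ℕ, moment (fun t => w t * v t) (-(k : ℤ)) = 0)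
    {u : Lp ℂ 2 dlam} (hu : u ∈ shiftSpan hw) : ∫ t, u t * v t ∂dlam = 0 := by
  refine integral_mul_eq_zero_of_mem_topologicalClosure hv ?_ hu
  rintro _ ⟨k, rfl⟩
  rw [integral_shift_mul, h]

/-- The part of `w` orthogonal to the functions `w(λ) e^{-inλ}`, `n ≥ 1`, has constant modulus. -/
theorem exists_innovation {w : Circ → ℂ} (hw : MemLp w 2 dlam) :
    ∃ q ∈ shiftSpan hw, (∀ v : Circ → ℂ, MemLp v 2 dlam →
        (∀ n : ℤ, n < 0 → moment (fun t => w t * v t) n = 0) →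
        ∫ t, q t * v t ∂dlam = ∫ t, w t * v t ∂dlam) ∧
      ∃ σ : ℝ, σ ≤ ∫ t, ‖w t‖ ^ 2 ∂dlam ∧ ∀ᵐ t ∂dlam, ‖q t‖ ^ 2 = σ := by
  -- The extra factor `e^{-iλ}` makes `N` the strict past, spanned by the shifts with `n ≥ 1`; `q`
  -- will be the one-step prediction error of `w`.
  have hw1 := memLp_mul_fourier hw (-1)
  set N := shiftSpan hw1
  set R := hw.toLp w
  have hRw : R =ᵐ[dlam] w := hw.coeFn_toLp
  have hshift : ∀ n, shift hw1 n = shift hw (-1 + n) := fun n => by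
    refine Lp.ext ((coeFn_shift _ _).trans (EventuallyEq.trans ?_ (coeFn_shift _ _).symm))
    exact ae_of_all _ fun t => by simp only [fourier_add, mul_assoc]
  have hR : R = shift hw (-((0 : ℕ) : ℤ)) := by
    refine Lp.ext (hRw.trans (EventuallyEq.trans ?_ (coeFn_shift _ _).symm))
    exact ae_of_all _ fun t => by simp
  have hN : N ≤ shiftSpan hw := by
    refine Submodule.topologicalClosure_mono (Submodule.span_mono ?_)
    rintro _ ⟨k, rfl⟩
    exact ⟨k + 1, by dsimp only; rw [hshift]; congr 1; push_cast; ring⟩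
  have hpN : N.starProjection R ∈ N := Submodule.starProjection_apply_mem _ _
  set q := R - N.starProjection R with hq
  have hqR : ∀ᵐ t ∂dlam, N.starProjection R t = w t - q t := by
    filter_upwards [hRw, Lp.coeFn_sub R (N.starProjection R)] with t h1 h2
    rw [h2, Pi.sub_apply, h1]; ring
  have hqmem : q ∈ shiftSpan hw :=
    Submodule.sub_mem _ (hR ▸ shift_mem_shiftSpan hw 0) (hN hpN)
  have hort : ∀ u ∈ N, inner ℂ u q = 0 := fun u hu =>
    inner_eq_zero_symm.1 (Submodule.starProjection_inner_eq_zero R u hu)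
  have hmom : ∀ n : ℤ, 0 < n → moment (fun t => q t * conj (w t)) n = 0 := fun n hn => by
    have h := hort _ (shift_mem_shiftSpan hw1 (n - 1).toNat)
    rw [hshift, inner_shift] at h
    rwa [show -(-1 + -((n - 1).toNat : ℤ)) = n by omega] at h
  refine ⟨q, hqmem, fun v hv h => ?_, ‖q‖ ^ 2, ?_, ?_⟩
  · have h1 : ∫ t, N.starProjection R t * v t ∂dlam = 0 := by
      refine integral_mul_eq_zero_of_mem_shiftSpan hw1 hv (fun k => ?_) hpN
      rw [← h (-1 + -(k : ℤ)) (by omega), ← moment_mul_fourier]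
      congr 1; ext t; ring
    have h2 : ∫ t, (w t * v t - q t * v t) ∂dlam = 0 := by
      rw [← h1]
      exact integral_congr_ae (hqR.mono fun t ht => by simp only [ht]; ring)
    have i1 : Integrable (fun t => w t * v t) dlam := hw.integrable_mul hv
    have i2 : Integrable (fun t => q t * v t) dlam := (Lp.memLp q).integrable_mul hv
    rw [integral_sub i1 i2] at h2
    exact (sub_eq_zero.1 h2).symm
  · have h1 := norm_add_sq_eq_norm_sq_add_norm_sq_of_inner_eq_zero q (N.starProjection R)
      (inner_eq_zero_symm.1 (hort _ hpN))
    rw [hq, sub_add_cancel, ← hq] at h1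
    have h2 : ‖R‖ ^ 2 = ∫ t, ‖w t‖ ^ 2 ∂dlam := by
      rw [norm_sq_eq_integral]
      exact integral_congr_ae (hRw.mono fun t ht => by simp only [ht])
    nlinarith [mul_self_nonneg ‖N.starProjection R‖]
  -- Orthogonality of `q` to the strict past of `w` extends from the shifts of `w` to those of `q`,
  -- which is itself in the closed span. So `|q|²` has no moment of negative order, by conjugation
  -- none of positive order, and it equals its mean.
  · have hneg : ∀ n : ℤ, n < 0 → moment (fun t => q t * conj (q t)) n = 0 := fun n hn => by
      have := integral_mul_eq_zero_of_mem_shiftSpan hw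
        (memLp_mul_fourier (memLp_conj (Lp.memLp q)) n) (fun k => ?_) hqmem
      · simpa only [moment, mul_assoc] using this
      · have h := moment_conj (fun t => q t * conj (w t)) (n + -k)
        rw [hmom _ (by omega), map_zero, ← moment_mul_fourier] at h
        simpa only [map_mul, Complex.conj_conj, mul_comm, mul_left_comm] using h
    have hqq : Integrable (fun t => q t * conj (q t)) dlam :=
      (Lp.memLp q).integrable_mul (memLp_conj (Lp.memLp q))
    have hz := ae_eq_zero_of_moment_eq_zero
      (v := fun t => q t * conj (q t) - ((‖q‖ ^ 2 : ℝ) : ℂ))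
      (hqq.sub (integrable_const _)) fun n => ?_
    · filter_upwards [hz] with t ht
      rw [Pi.zero_apply, sub_eq_zero, Complex.mul_conj, Complex.normSq_eq_norm_sq] at ht
      exact_mod_cast ht
    · have hc : moment (fun _ => ((‖q‖ ^ 2 : ℝ) : ℂ)) n = if n = 0 then ((‖q‖ ^ 2 : ℝ) : ℂ) else 0 := by
        have := moment_fourier 0 n
        simp only [moment, fourier_zero, one_mul, zero_add] at this
        simp only [moment, integral_const_mul, this]
        simp
      rw [moment_sub hqq (integrable_const _), hc]
      rcases lt_trichotomy n 0 with hn | rfl | hn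
      · simp [hneg n hn, hn.ne]
      · rw [if_pos rfl, norm_sq_eq_integral, ← integral_complex_ofReal, sub_eq_zero]
        refine integral_congr_ae (ae_of_all _ fun t => ?_)
        simp [Complex.mul_conj, Complex.normSq_eq_norm_sq]
      · have h := moment_conj (fun t => q t * conj (q t)) n
        rw [hneg _ (by omega), map_zero] at h
        simp only [map_mul, Complex.conj_conj, mul_comm (conj _)] at h
        simp [h, hn.ne']

/-! ### Products with one-sided series -/

/-- Multipliers close to one, which make a given integrable function square integrable and
preserve the vanishing of its moments of nonpositive order. -/
theorem exists_multiplier {v : Circ → ℂ} (hv : Integrable v dlam)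
    (h : ∀ n ≤ 0, moment v n = 0) {ε : ℝ} (hε : 0 < ε) :
    ∃ κ : Circ → ℂ, MemLp κ 2 dlam ∧
      (∀ᵐ t ∂dlam, ‖κ t‖ ^ 2 ≤ 1 + ε * ∫ t, ‖v t‖ ∂dlam) ∧
      ∫ t, ‖κ t - 1‖ ^ 2 ∂dlam ≤ ε * ∫ t, ‖v t‖ ∂dlam ∧
      MemLp (fun t => κ t ^ 2 * v t) 2 dlam ∧
      ∀ n ≤ 0, moment (fun t => κ t ^ 2 * v t) n = 0 := by
  -- The multiplier is `κ = q / r`, with `q` the innovation of `r`. Then `|κ|² = σ / (1 + ε|v|)`, so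
  -- `κ² v` is bounded by `σ / ε`.
  set r : Circ → ℝ := fun t => √(1 + ε * ‖v t‖)
  have hr2 : ∀ t, r t ^ 2 = 1 + ε * ‖v t‖ := fun t => Real.sq_sqrt (by positivity)
  have hr1 : ∀ t, 1 ≤ r t := fun t => Real.one_le_sqrt.2 (by simp; positivity)
  have hr0 : ∀ t, (r t : ℂ) ≠ 0 := fun t => by
    exact_mod_cast (zero_lt_one.trans_le (hr1 t)).ne'
  have hrm : AEStronglyMeasurable (fun t => (r t : ℂ)) dlam := by
    have h1 := hv.1.norm.aemeasurable
    exact (by fun_prop : AEMeasurable (fun t => (r t : ℂ)) dlam).aestronglyMeasurable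
  have hrim : AEStronglyMeasurable (fun t => (r t : ℂ)⁻¹) dlam :=
    hrm.aemeasurable.inv.aestronglyMeasurable
  have hri : ∀ t, ‖(r t : ℂ)⁻¹‖ ≤ 1 := fun t => by
    rw [norm_inv, Complex.norm_real, Real.norm_of_nonneg (zero_le_one.trans (hr1 t))]
    exact inv_le_one_of_one_le₀ (hr1 t)
  have hrn : ∀ t, ‖(r t : ℂ)‖ ^ 2 = 1 + ε * ‖v t‖ := fun t => by
    rw [Complex.norm_real, Real.norm_eq_abs, sq_abs, hr2]
  have hr : MemLp (fun t => (r t : ℂ)) 2 dlam := by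
    rw [memLp_two_iff_integrable_sq_norm hrm]
    simp only [hrn]
    exact (integrable_const _).add (hv.norm.const_mul _)
  have hrint : ∫ t, ‖(r t : ℂ)‖ ^ 2 ∂dlam = 1 + ε * ∫ t, ‖v t‖ ∂dlam := by
    simp only [hrn]
    rw [integral_add (integrable_const _) (hv.norm.const_mul _), integral_const_mul]
    simp
  have hvr : ∀ t, ‖v t‖ * ‖(r t : ℂ)⁻¹‖ ^ 2 ≤ ε⁻¹ := fun t => by
    rw [norm_inv, inv_pow, hrn, ← div_eq_mul_inv, div_le_iff₀ (by positivity), mul_add,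
      inv_mul_cancel_left₀ hε.ne']
    have : 0 < ε⁻¹ := by positivity
    linarith
  obtain ⟨q, hqmem, hqint, σ, hσ, hqσ⟩ := exists_innovation hr
  rw [hrint] at hσ
  have hqm := Lp.aestronglyMeasurable q
  have hκσ : ∀ᵐ t ∂dlam, ‖q t * (r t : ℂ)⁻¹‖ ^ 2 ≤ σ := by
    filter_upwards [hqσ] with t ht
    rw [norm_mul, mul_pow, ht]
    have : ‖(r t : ℂ)⁻¹‖ ^ 2 ≤ 1 := pow_le_one₀ (norm_nonneg _) (hri t)
    have hσ0 : 0 ≤ σ := ht ▸ sq_nonneg _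
    nlinarith
  have hκ : MemLp (fun t => q t * (r t : ℂ)⁻¹) 2 dlam :=
    MemLp.of_bound (hqm.mul hrim) (√σ) (hκσ.mono fun t ht => Real.le_sqrt_of_sq_le ht)
  have hri2 : MemLp (fun t => (r t : ℂ)⁻¹) 2 dlam := MemLp.of_bound hrim 1 (ae_of_all _ hri)
  -- Test the innovation against `1 / r`: its product with `r` is the constant one. With `∫ |κ|² ≤ σ
  -- ≤ 1 + ε ∫ |v|`, expanding the square bounds `∫ |κ - 1|²`.
  have hκ1 : ∫ t, q t * (r t : ℂ)⁻¹ ∂dlam = 1 := by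
    rw [hqint _ hri2 fun n hn => ?_]
    · simp [hr0]
    · have := moment_fourier 0 n
      simp only [moment, fourier_zero, one_mul, zero_add, hn.ne, if_false] at this
      simpa [hr0, moment] using this
  have hvri : MemLp (fun t => v t * (r t : ℂ)⁻¹) 2 dlam := by
    refine (memLp_two_iff_integrable_sq_norm (hv.1.mul hrim)).2 ?_
    refine (hv.norm.const_mul ε⁻¹).mono' ((hv.1.mul hrim).norm.pow 2) (ae_of_all _ fun t => ?_)
    rw [Real.norm_of_nonneg (by positivity), Pi.mul_apply, norm_mul, mul_pow]
    nlinarith [hvr t, norm_nonneg (v t)]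
  have hqv : ∀ᵐ t ∂dlam, ‖q t * v t * (r t : ℂ)⁻¹ ^ 2‖ ≤ √σ * ε⁻¹ := by
    filter_upwards [hqσ] with t ht
    rw [norm_mul, norm_mul, norm_pow, mul_assoc]
    exact mul_le_mul (Real.le_sqrt_of_sq_le ht.le) (hvr t) (by positivity) (by positivity)
  have hqvm : MemLp (fun t => q t * v t * (r t : ℂ)⁻¹ ^ 2) 2 dlam :=
    MemLp.of_bound ((hqm.mul hv.1).mul (hrim.pow 2)) _ hqv
  -- On a generator `r e^{-ikλ}` the factor `r` cancels and a moment of `v` of nonpositive order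
  -- remains. This passage to the closed span is used twice, once for each factor `q` of `κ² v = q²
  -- v / r²`.
  have step : ∀ n ≤ 0, ∀ u ∈ shiftSpan hr, moment (fun t => u t * (v t * (r t : ℂ)⁻¹)) n = 0 := by
    intro n hn u hu
    have := integral_mul_eq_zero_of_mem_shiftSpan hr (memLp_mul_fourier hvri n) (fun k => ?_) hu
    · simpa only [moment, mul_assoc] using this
    · rw [← h (n + -(k : ℤ)) (by omega), ← moment_mul_fourier]
      congr 1; ext t; field_simp [hr0 t]
  refine ⟨fun t => q t * (r t : ℂ)⁻¹, hκ, hκσ.mono fun t ht => ht.trans hσ, ?_, ?_, ?_⟩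
  · have e : ∀ t, ‖q t * (r t : ℂ)⁻¹ - 1‖ ^ 2 =
        ‖q t * (r t : ℂ)⁻¹‖ ^ 2 - 2 * (q t * (r t : ℂ)⁻¹).re + 1 := fun t => by
      rw [← Complex.normSq_eq_norm_sq, Complex.normSq_sub, Complex.normSq_eq_norm_sq]
      simp; ring
    have i1 : Integrable (fun t => q t * (r t : ℂ)⁻¹) dlam := hκ.integrable (by norm_num)
    have i2 := (memLp_two_iff_integrable_sq_norm hκ.1).1 hκ
    have hre : ∫ t, (q t * (r t : ℂ)⁻¹).re ∂dlam = 1 := by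
      have := integral_re i1
      simp only [RCLike.re_to_complex] at this
      rw [this, hκ1]; simp
    simp only [e]
    have i3 : Integrable (fun t => 2 * (q t * (r t : ℂ)⁻¹).re) dlam := i1.re.const_mul 2
    have i4 : Integrable
        (fun t => ‖q t * (r t : ℂ)⁻¹‖ ^ 2 - 2 * (q t * (r t : ℂ)⁻¹).re) dlam := i2.sub i3
    rw [integral_add i4 (integrable_const _), integral_sub i2 i3, integral_const_mul, hre]
    have : ∫ t, ‖q t * (r t : ℂ)⁻¹‖ ^ 2 ∂dlam ≤ σ := by
      refine (integral_mono_ae i2 (integrable_const σ) hκσ).trans ?_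
      simp
    rw [integral_const, probReal_univ, one_smul]
    linarith
  · refine MemLp.of_bound (((hqm.mul hrim).pow 2).mul hv.1) (√σ * (√σ * ε⁻¹)) ?_
    filter_upwards [hqv, hqσ] with t h1 h2
    rw [show (q t * (r t : ℂ)⁻¹) ^ 2 * v t = q t * (q t * v t * (r t : ℂ)⁻¹ ^ 2) by ring, norm_mul]
    exact mul_le_mul (Real.le_sqrt_of_sq_le h2.le) h1 (norm_nonneg _) (by positivity)
  · intro n hn
    have := integral_mul_eq_zero_of_mem_shiftSpan hr (memLp_mul_fourier hqvm n) (fun k => ?_) hqmem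
    · rw [← this, moment]
      congr 1; ext t; ring
    · rw [← step (n + -(k : ℤ)) (by omega) q hqmem, ← moment_mul_fourier]
      congr 1; ext t; field_simp [hr0 t]

/-- If the moments of nonpositive order of an integrable function vanish, then so do those of its
product with a one-sided series, provided that the product is integrable. -/
theorem moment_mul_series_eq_zero {v : Circ → ℂ} (hv : Integrable v dlam)
    (h : ∀ n ≤ 0, moment v n = 0) {y : ℕ → ℂ} (hy : Memℓp y 2)
    (hvy : Integrable (fun t => v t * series y t) dlam) {n : ℤ} (hn : n ≤ 0) :
    moment (fun t => v t * series y t) n = 0 := by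
  -- Taking `ε = 1/(k+1)` sends `κ` to one in `L₂`, and `ε ≤ 1` gives a bound for `|κ|²` uniform in
  -- `k`, as dominated convergence requires.
  have hε : ∀ k : ℕ, 0 < 1 / ((k : ℝ) + 1) := fun k => by positivity
  choose κ hκ hκb hκ1 hκm hκ0 using fun k : ℕ => exists_multiplier hv h (hε k)
  have hI : 0 ≤ ∫ t, ‖v t‖ ∂dlam := integral_nonneg fun t => norm_nonneg _
  -- Since `κ² v` is square integrable, the series of `y` can be expanded term by term.
  have hz : ∀ k, moment (fun t => κ k t ^ 2 * v t * series y t) n = 0 := fun k => by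
    have h1 := hasSum_mul_moment hy (memLp_mul_fourier (hκm k) n)
    simp only [moment_mul_fourier] at h1
    have h2 : ∀ j : ℕ, moment (fun t => κ k t ^ 2 * v t) (n + -(j : ℤ)) = 0 := fun j =>
      hκ0 k _ (by omega)
    simp only [h2, mul_zero] at h1
    rw [← h1.unique hasSum_zero, moment]
    congr 1; ext t; ring
  have hlim : Tendsto (fun k => eLpNorm (κ k - 1) 2 dlam) atTop (𝓝 0) := by
    have hm : ∀ k, MemLp (κ k - 1) 2 dlam := fun k => (hκ k).sub (memLp_const 1)
    have e : ∀ k, eLpNorm (κ k - 1) 2 dlam = ENNReal.ofReal (√(∫ t, ‖κ k t - 1‖ ^ 2 ∂dlam)) :=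
      fun k => by
        rw [(hm k).eLpNorm_eq_integral_rpow_norm (by norm_num) (by norm_num), Real.sqrt_eq_rpow]
        simp
    simp only [e]
    rw [← ENNReal.ofReal_zero]
    refine ENNReal.tendsto_ofReal ?_
    rw [← Real.sqrt_zero]
    refine (Real.continuous_sqrt.tendsto 0).comp ?_
    refine squeeze_zero (fun k => integral_nonneg fun t => by positivity) hκ1 ?_
    simpa using tendsto_one_div_add_atTop_nhds_zero_nat.mul_const (∫ t, ‖v t‖ ∂dlam)
  obtain ⟨ns, -, hns⟩ := (tendstoInMeasure_of_tendsto_eLpNorm two_ne_zero (fun k => (hκ k).1)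
    aestronglyMeasurable_const hlim).exists_seq_tendsto_ae
  have hdct : Tendsto (fun k => moment (fun t => κ (ns k) t ^ 2 * v t * series y t) n) atTop
      (𝓝 (moment (fun t => v t * series y t) n)) := by
    refine tendsto_integral_of_dominated_convergence
      (fun t => (1 + ∫ t, ‖v t‖ ∂dlam) * ‖v t * series y t‖) (fun k => ?_)
      (hvy.norm.const_mul _) (fun k => ?_) ?_
    · exact ((((hκ _).1.pow 2).mul hv.1).mul (memLp_series y).1).mul
        (fourier n).continuous.aestronglyMeasurable
    · filter_upwards [hκb (ns k)] with t ht
      rw [norm_mul, norm_fourier_apply, mul_one, mul_assoc, norm_mul, norm_pow]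
      refine mul_le_mul_of_nonneg_right (ht.trans ?_) (norm_nonneg _)
      have : 1 / ((ns k : ℝ) + 1) ≤ 1 := by
        rw [div_le_one (by positivity)]
        have : (0 : ℝ) ≤ ns k := by positivity
        linarith
      nlinarith
    · filter_upwards [hns] with t ht
      replace ht : Tendsto (fun k => κ (ns k) t) atTop (𝓝 1) := ht
      have := (((ht.pow 2).mul_const (v t)).mul_const (series y t)).mul_const (fourier n t)
      simpa only [one_pow, one_mul] using this
  simp only [hz] at hdct
  exact tendsto_nhds_unique hdct tendsto_const_nhds


/-- A one-sided series with a reciprocal one-sided series is outer: its shifts span all one-sided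
series. -/
theorem series_mem_shiftSpan {ψ θ : ℕ → ℂ} (hψ : Memℓp ψ 2) (hθ : Memℓp θ 2)
    (hrec : ∀ᵐ t ∂dlam, series ψ t * series θ t = 1) {z : ℕ → ℂ} (hz : Memℓp z 2) :
    series z ∈ shiftSpan (memLp_series θ) := by
  set K := shiftSpan (memLp_series θ)
  set u := series z - K.starProjection (series z) with hu
  have hpK : K.starProjection (series z) ∈ K := Submodule.starProjection_apply_mem _ _
  have hui : Integrable u dlam := (Lp.memLp u).integrable (by norm_num)
  -- Both the series of `z` and every element of `K` are one-sided.
  have hneg : ∀ n : ℤ, n < 0 → moment u n = 0 := fun n hn => by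
    have h1 : moment (K.starProjection (series z)) n = 0 := by
      have hw : MemLp (fun t => (1 : ℂ) * fourier n t) 2 dlam :=
        memLp_mul_fourier (memLp_const (1 : ℂ)) n
      simp only [one_mul] at hw
      refine integral_mul_eq_zero_of_mem_shiftSpan _ hw (fun k => ?_) hpK
      rw [moment_mul_fourier, moment_series_of_neg hθ (by omega)]
    rw [moment_congr (Lp.coeFn_sub _ _)]
    simp only [Pi.sub_def]
    rw [moment_sub (integrable_series z) ((Lp.memLp _).integrable (by norm_num)), h1,
      moment_series_of_neg hz hn, sub_zero]
  have hv0 : ∀ n : ℤ, n ≤ 0 → moment (fun t => series θ t * conj (u t)) n = 0 := fun n hn => by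
    have h1 : inner ℂ (shift (memLp_series θ) (-(n.natAbs : ℤ))) u = 0 := inner_eq_zero_symm.1
      (Submodule.starProjection_inner_eq_zero _ _ (shift_mem_shiftSpan _ _))
    rw [inner_shift, neg_neg, show ((n.natAbs : ℤ)) = -n by omega] at h1
    have h2 := moment_conj (fun t => u t * conj (series θ t)) n
    rw [h1, map_zero] at h2
    simpa only [map_mul, Complex.conj_conj, mul_comm] using h2
  have hvi : Integrable (fun t => series θ t * conj (u t)) dlam :=
    (memLp_series θ).integrable_mul (memLp_conj (Lp.memLp u))
  have hvu : (fun t => series θ t * conj (u t) * series ψ t) =ᵐ[dlam] fun t => conj (u t) := by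
    filter_upwards [hrec] with t ht
    linear_combination conj (u t) * ht
  have hui' : Integrable (fun t => conj (u t)) dlam :=
    (memLp_conj (Lp.memLp u)).integrable (by norm_num)
  -- Orthogonality of `u` to the shifts concerns `θ conj u`; multiplying by `ψ` removes `θ` and
  -- keeps the vanishing moments. Together with `hneg` no moment of `u` survives.
  have hpos : ∀ n : ℤ, n ≤ 0 → moment (fun t => conj (u t)) n = 0 := fun n hn => by
    rw [← moment_congr hvu]
    exact moment_mul_series_eq_zero hvi hv0 hψ (hui'.congr hvu.symm) hn
  have hu0 : u = 0 := by
    refine Lp.ext ((ae_eq_zero_of_moment_eq_zero hui fun n => ?_).trans (Lp.coeFn_zero _ _ _).symm)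
    rcases lt_or_ge n 0 with hn | hn
    · exact hneg n hn
    · have := hpos (-n) (by omega)
      rw [moment_conj, neg_neg] at this
      simpa using this
  rw [sub_eq_zero.1 (hu.symm.trans hu0)]
  exact hpK

/-! ### The spectral representation -/

theorem eLpNorm_spectralMeasure {F : Circ → ℝ} {w : Circ → ℂ} (hw : MemLp w 2 dlam)
    (hF : ∀ᵐ t ∂dlam, F t = ‖w t‖ ^ 2) (x : Circ → ℂ) :
    eLpNorm x 2 (spectralMeasure F) = eLpNorm (fun t => x t * w t) 2 dlam := by
  have hm : spectralMeasure F = dlam.withDensity fun t => ‖w t‖ₑ ^ 2 :=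
    withDensity_congr_ae (hF.mono fun t ht => by
      simp only [ht]
      rw [ENNReal.ofReal_pow (norm_nonneg _), ofReal_norm])
  rw [hm, eLpNorm_eq_lintegral_rpow_enorm_toReal (by norm_num) (by norm_num),
    eLpNorm_eq_lintegral_rpow_enorm_toReal (by norm_num) (by norm_num),
    lintegral_withDensity_eq_lintegral_mul_non_measurable₀ _ (hw.1.enorm.pow_const 2)
      (ae_of_all _ fun t => ENNReal.pow_lt_top enorm_lt_top)]
  simp [enorm_mul, mul_pow, mul_comm]

theorem memLp_spectralMeasure_iff {F : Circ → ℝ} {w : Circ → ℂ} (hw : MemLp w 2 dlam)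
    (hF : ∀ᵐ t ∂dlam, F t = ‖w t‖ ^ 2) (hw0 : ∀ᵐ t ∂dlam, w t ≠ 0) (x : Circ → ℂ) :
    MemLp x 2 (spectralMeasure F) ↔ MemLp (fun t => x t * w t) 2 dlam := by
  have hFm : AEMeasurable (fun t => ENNReal.ofReal (F t)) dlam :=
    ((hw.1.norm.pow 2).aemeasurable.congr
      (EventuallyEq.symm hF)).ennreal_ofReal
  have hac : dlam ≪ spectralMeasure F := withDensity_absolutelyContinuous' hFm (by
    filter_upwards [hF, hw0] with t h1 h2
    rw [h1]
    simpa using h2)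
  rw [MemLp, MemLp, eLpNorm_spectralMeasure hw hF]
  refine and_congr_left fun _ => ⟨fun h => (h.mono_ac hac).mul hw.1, fun h => ?_⟩
  refine AEStronglyMeasurable.mono_ac (withDensity_absolutelyContinuous _ _) ?_
  refine (h.mul hw.1.aemeasurable.inv.aestronglyMeasurable).congr ?_
  filter_upwards [hw0] with t ht
  simp [ht]

theorem coeFn_sum_smul_shift {w : Circ → ℂ} (hw : MemLp w 2 dlam) (p : ℤ →₀ ℂ) :
    (p.sum fun k c => c • shift hw k : Lp ℂ 2 dlam) =ᵐ[dlam]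
      fun t => (p.sum fun k c => c * fourier k t) * w t := by
  induction p using Finsupp.induction_linear with
  | zero => simpa [Pi.zero_def] using Lp.coeFn_zero ℂ 2 dlam
  | add p q hp hq =>
    rw [Finsupp.sum_add_index' (by simp) (by simp [add_smul])]
    filter_upwards [Lp.coeFn_add (p.sum fun k c => c • shift hw k) (q.sum fun k c => c • shift hw k),
      hp, hq] with t h1 h2 h3
    rw [h1, Pi.add_apply, h2, h3, Finsupp.sum_add_index' (by simp) (by simp [add_mul]), add_mul]
  | single k c =>
    rw [Finsupp.sum_single_index (by simp)]
    filter_upwards [Lp.coeFn_smul c (shift hw k), coeFn_shift hw k] with t h1 h2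
    rw [h1, Pi.smul_apply, h2, Finsupp.sum_single_index (by simp), smul_eq_mul]
    ring

section

variable {Ω : Type*} [MeasurableSpace Ω] {P : Measure Ω}

/-- Multiplication by `w` is an isometry of `L₂(F)` into `L₂` taking `e^{ikλ}` to the shifts of `w`.
-/
theorem isSpectralIntegral_iff {F : Circ → ℝ} {w : Circ → ℂ} (hw : MemLp w 2 dlam)
    (hF : ∀ᵐ t ∂dlam, F t = ‖w t‖ ^ 2) (hw0 : ∀ᵐ t ∂dlam, w t ≠ 0) (ζ : ℤ → Lp ℂ 2 P)
    (h : Circ → ℂ) (Y : Lp ℂ 2 P) :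
    IsSpectralIntegral F ζ h Y ↔ ∃ hv : MemLp (fun t => h t * w t) 2 dlam, ∃ p : ℕ → ℤ →₀ ℂ,
      Tendsto (fun n => (p n).sum fun k c => c • shift hw k) atTop (𝓝 (hv.toLp _)) ∧
      Tendsto (fun n => (p n).sum fun k c => c • ζ k) atTop (𝓝 Y) := by
  rw [IsSpectralIntegral, memLp_spectralMeasure_iff hw hF hw0, ← exists_prop]
  refine exists_congr fun hv => exists_congr fun p => and_congr_left fun _ => ?_
  rw [tendsto_iff_edist_tendsto_0]
  refine iff_of_eq (congrArg (Tendsto · atTop (𝓝 0)) (funext fun n => ?_))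
  rw [eLpNorm_spectralMeasure hw hF, edist_comm, Lp.edist_def]
  refine eLpNorm_congr_ae ?_
  filter_upwards [coeFn_sum_smul_shift hw (p n), hv.coeFn_toLp] with t h1 h2
  rw [Pi.sub_apply, h1, h2, sub_mul]

variable {H₁ H₂ : Type*} [NormedAddCommGroup H₁] [InnerProductSpace ℂ H₁]
  [NormedAddCommGroup H₂] [InnerProductSpace ℂ H₂]

theorem inner_linearCombination_eq {ι : Type*} {S : ι → H₁} {ζ : ι → H₂}
    (h : ∀ m n, inner ℂ (ζ m) (ζ n) = inner ℂ (S m) (S n)) (p p' : ι →₀ ℂ) :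
    inner ℂ (Finsupp.linearCombination ℂ ζ p) (Finsupp.linearCombination ℂ ζ p') =
      inner ℂ (Finsupp.linearCombination ℂ S p) (Finsupp.linearCombination ℂ S p') := by
  simp only [Finsupp.linearCombination_apply, Finsupp.sum_inner, Finsupp.inner_sum,
    inner_smul_left, inner_smul_right, h]

/-- Replaces the isometry between the two closed spans: convergence of linear combinations transfers
with the same coefficients. -/
theorem dist_linearCombination_eq {ι : Type*} {S : ι → H₁} {ζ : ι → H₂}
    (h : ∀ m n, inner ℂ (ζ m) (ζ n) = inner ℂ (S m) (S n)) (p p' : ι →₀ ℂ) :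
    dist (Finsupp.linearCombination ℂ ζ p) (Finsupp.linearCombination ℂ ζ p') =
      dist (Finsupp.linearCombination ℂ S p) (Finsupp.linearCombination ℂ S p') := by
  rw [dist_eq_norm, dist_eq_norm, ← map_sub, ← map_sub, @norm_eq_sqrt_re_inner ℂ,
    @norm_eq_sqrt_re_inner ℂ _ _ _ _ (Finsupp.linearCombination ℂ S _),
    inner_linearCombination_eq h]

theorem inner_eq_zero_of_mem_pastSpace {ζ : ℤ → Lp ℂ 2 P} {v Z : Lp ℂ 2 P}
    (h : ∀ k : ℕ, inner ℂ v (ζ (-(k : ℤ))) = 0) (hZ : Z ∈ pastSpace ζ) : inner ℂ v Z = 0 := by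
  have : pastSpace ζ ≤ (Submodule.span ℂ {v})ᗮ := by
    refine Submodule.topologicalClosure_minimal _ (Submodule.span_le.2 ?_)
      (Submodule.isClosed_orthogonal _)
    rintro _ ⟨k, rfl⟩
    exact Submodule.mem_orthogonal_singleton_iff_inner_right.2 (h k)
  exact Submodule.mem_orthogonal_singleton_iff_inner_right.1 (this hZ)

/-- If `ζ(n)` has the Gram matrix of `w(λ) e^{inλ}` and `u` in the closed span of `w(λ) e^{-ikλ}`,
`k ≥ 0`, has the same products with them as `X` with `ζ(-k)`, then `u` represents the optimal
estimate of `X`. -/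
theorem IsOptimalEstimate.exists_tendsto {ζ : ℤ → Lp ℂ 2 P} {X Y : Lp ℂ 2 P}
    (hY : IsOptimalEstimate ζ X Y) {w : Circ → ℂ} (hw : MemLp w 2 dlam)
    (hζ : ∀ m n, inner ℂ (ζ m) (ζ n) = inner ℂ (shift hw m) (shift hw n)) {u : Lp ℂ 2 dlam}
    (hu : u ∈ shiftSpan hw)
    (hX : ∀ k : ℕ, inner ℂ (ζ (-(k : ℤ))) X = inner ℂ (shift hw (-(k : ℤ))) u) :
    (∃ p : ℕ → ℤ →₀ ℂ,
      Tendsto (fun n => Finsupp.linearCombination ℂ (shift hw) (p n)) atTop (𝓝 u) ∧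
      Tendsto (fun n => Finsupp.linearCombination ℂ ζ (p n)) atTop (𝓝 Y)) ∧
    ‖X - Y‖ ^ 2 = ‖X‖ ^ 2 - ‖u‖ ^ 2 := by
  obtain ⟨x, hx, hxu⟩ := mem_closure_iff_seq_limit.1 hu
  choose c hc using fun n => Finsupp.mem_span_range_iff_exists_finsupp.1 (hx n)
  -- Coefficients supported on indices `≤ 0`, so the same combinations of `ζ` stay in the past.
  set p : ℕ → ℤ →₀ ℂ := fun n => (c n).mapDomain fun k : ℕ => -(k : ℤ)
  have hV : Tendsto (fun n => Finsupp.linearCombination ℂ (shift hw) (p n)) atTop (𝓝 u) := by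
    refine hxu.congr fun n => ?_
    rw [Finsupp.linearCombination_mapDomain, Finsupp.linearCombination_apply]
    exact (hc n).symm
  obtain ⟨Y', hY'⟩ := cauchySeq_tendsto_of_complete
    (u := fun n => Finsupp.linearCombination ℂ ζ (p n)) (by
      have := hV.cauchySeq
      rw [Metric.cauchySeq_iff] at this ⊢
      simpa only [dist_linearCombination_eq hζ] using this)
  have hpast : ∀ n, Finsupp.linearCombination ℂ ζ (p n) ∈
      Submodule.span ℂ (Set.range fun k : ℕ => ζ (-(k : ℤ))) := fun n => by
    rw [Finsupp.linearCombination_mapDomain, Finsupp.linearCombination_apply]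
    exact Finsupp.mem_span_range_iff_exists_finsupp.2 ⟨c n, rfl⟩
  have hYp : Y' ∈ pastSpace ζ :=
    mem_closure_of_tendsto hY' (Eventually.of_forall hpast)
  have hin : ∀ k : ℕ, inner ℂ (X - Y') (ζ (-(k : ℤ))) = 0 := fun k => by
    rw [inner_eq_zero_symm, inner_sub_right, hX, sub_eq_zero]
    refine tendsto_nhds_unique ((tendsto_const_nhds (x := shift hw (-(k : ℤ)))).inner hV (𝕜 := ℂ)) ?_
    refine ((tendsto_const_nhds (x := ζ (-(k : ℤ)))).inner hY' (𝕜 := ℂ)).congr fun n => ?_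
    simpa using inner_linearCombination_eq hζ (Finsupp.single (-(k : ℤ)) 1) (p n)
  have hopt : IsOptimalEstimate ζ X Y' := by
    refine ⟨hYp, fun Z hZ => ?_⟩
    have h1 := norm_add_sq_eq_norm_sq_add_norm_sq_of_inner_eq_zero (X - Y') (Y' - Z)
      (inner_eq_zero_of_mem_pastSpace hin (Submodule.sub_mem _ hYp hZ))
    rw [sub_add_sub_cancel] at h1
    exact le_of_sq_le_sq (by nlinarith [sq_nonneg ‖Y' - Z‖]) (norm_nonneg _)
  obtain rfl := (existsUnique_isOptimalEstimate ζ X).unique hopt hY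
  refine ⟨⟨p, hV, hY'⟩, ?_⟩
  have h1 := norm_add_sq_eq_norm_sq_add_norm_sq_of_inner_eq_zero (X - Y') Y'
    (inner_eq_zero_of_mem_pastSpace hin hYp)
  have h2 : ‖Y'‖ = ‖u‖ := by
    refine tendsto_nhds_unique hY'.norm (hV.norm.congr fun n => ?_)
    simpa using (dist_linearCombination_eq hζ (p n) 0).symm
  rw [sub_add_cancel, h2] at h1
  linarith

theorem isSpectralIntegral_iff_of_tendsto {F : Circ → ℝ} {w : Circ → ℂ} (hw : MemLp w 2 dlam)
    (hF : ∀ᵐ t ∂dlam, F t = ‖w t‖ ^ 2) (hw0 : ∀ᵐ t ∂dlam, w t ≠ 0) {ζ : ℤ → Lp ℂ 2 P}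
    (hζ : ∀ m n, inner ℂ (ζ m) (ζ n) = inner ℂ (shift hw m) (shift hw n)) {u : Lp ℂ 2 dlam}
    {Y : Lp ℂ 2 P} {p : ℕ → ℤ →₀ ℂ}
    (hpu : Tendsto (fun n => Finsupp.linearCombination ℂ (shift hw) (p n)) atTop (𝓝 u))
    (hpY : Tendsto (fun n => Finsupp.linearCombination ℂ ζ (p n)) atTop (𝓝 Y)) (h : Circ → ℂ) :
    IsSpectralIntegral F ζ h Y ↔ (fun t => h t * w t) =ᵐ[dlam] u := by
  rw [isSpectralIntegral_iff hw hF hw0]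
  constructor
  · rintro ⟨hv, p', h1, h2⟩
    have : hv.toLp _ = u := by
      have h3 := h2.dist hpY
      rw [dist_self] at h3
      exact dist_eq_zero.1 (tendsto_nhds_unique (h1.dist hpu)
        (h3.congr fun n => dist_linearCombination_eq hζ (p' n) (p n)))
    rw [← this]
    exact hv.coeFn_toLp.symm
  · intro hu
    have hv := (Lp.memLp u).ae_eq hu.symm
    have : hv.toLp _ = u := Lp.ext (hv.coeFn_toLp.trans hu)
    exact ⟨hv, p, this ▸ hpu, hpY⟩

end


theorem memLp_mul_series_of_summable_norm {u : Circ → ℂ} (hu : MemLp u 2 dlam) {a : ℕ → ℂ}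
    (ha : Summable fun k => ‖a k‖) : MemLp (fun t => u t * series a t) 2 dlam := by
  obtain ⟨C, hC⟩ := exists_norm_series_le ha
  refine hu.of_le_mul (c := C) (hu.1.mul (memLp_series a).1) (hC.mono fun t ht => ?_)
  rw [norm_mul, mul_comm]
  exact mul_le_mul_of_nonneg_right ht (norm_nonneg _)

theorem integrable_mul_series_of_summable_norm {u : Circ → ℂ} (hu : Integrable u dlam) {a : ℕ → ℂ}
    (ha : Summable fun k => ‖a k‖) : Integrable (fun t => u t * series a t) dlam := by
  obtain ⟨C, hC⟩ := exists_norm_series_le ha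
  exact hu.mul_bdd (memLp_series a).1 hC

theorem conjMat_fourierMat (F : Circ → ℝ) (k j : ℕ) :
    conjMat (fourierMat F) k j = moment (fun t => (F t : ℂ)) ((k : ℤ) - j) := by
  have h := moment_conj (fun t => (F t : ℂ)) ((k : ℤ) - j)
  simp only [Complex.conj_ofReal] at h
  rw [h, conjMat, Matrix.map_apply, fourierMat, Matrix.of_apply]
  simp only [fourierCoeff, moment, smul_eq_mul, mul_comm]

theorem norm_series_sq_eq_pairing {y : ℕ → ℂ} (hy : Memℓp y 2) :
    ((‖series y‖ ^ 2 : ℝ) : ℂ) = pairing y y := by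
  have h := (hasSum_moment_mul_conj_series hy (memLp_series y) 0).tsum_eq
  simp only [zero_add, moment_series hy] at h
  rw [pairing, h, norm_sq_eq_integral, ← integral_complex_ofReal, moment]
  refine integral_congr_ae (ae_of_all _ fun t => ?_)
  simp [Complex.mul_conj, Complex.normSq_eq_norm_sq]

/-! ### Spectral densities and their factorizations -/

section

variable {f g : Circ → ℝ} {ψ θ φ : ℕ → ℂ}

theorem IsCanonicalFactorization.series_ne_zero {F : Circ → ℝ}
    (h : IsCanonicalFactorization F ψ θ) : ∀ᵐ t ∂dlam, series θ t ≠ 0 :=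
  h.recip.mono fun _ ht => right_ne_zero_of_mul_eq_one ht

theorem IsCanonicalFactorization.eq_norm_sq {F : Circ → ℝ}
    (h : IsCanonicalFactorization F ψ θ) : ∀ᵐ t ∂dlam, F t = ‖series θ t‖ ^ 2 :=
  h.eqθ.mono fun _ ht => inv_injective ht

theorem integrable_complex_ofReal (hf : Integrable f dlam) :
    Integrable (fun t => (f t : ℂ)) dlam :=
  hf.ofReal

theorem IsDensity.div_add_le_one (hf : IsDensity f) (hg : IsDensity g) :
    ∀ᵐ t ∂dlam, 0 ≤ f t / (f t + g t) ∧ f t / (f t + g t) ≤ 1 := by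
  filter_upwards [hf.nonneg, hg.nonneg] with t h1 h2
  simp only [Pi.zero_apply] at h1 h2
  exact ⟨by positivity, div_le_one_of_le₀ (by linarith) (by positivity)⟩

theorem memLp_div_add (hf : IsDensity f) (hg : IsDensity g) :
    MemLp (fun t => ((f t / (f t + g t) : ℝ) : ℂ)) 2 dlam := by
  have hm : AEMeasurable (fun t => f t / (f t + g t)) dlam :=
    hf.integrable.aemeasurable.div (hf.integrable.aemeasurable.add hg.integrable.aemeasurable)
  refine MemLp.of_bound hm.complex_ofReal.aestronglyMeasurable 1
    ((hf.div_add_le_one hg).mono fun t ht => ?_)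
  rw [Complex.norm_real, Real.norm_of_nonneg ht.1]
  exact ht.2

theorem IsCanonicalFactorization.mul_norm_sq_eq (h : IsCanonicalFactorization (f + g) ψ θ) :
    ∀ᵐ t ∂dlam, f t * ‖series ψ t‖ ^ 2 = f t / (f t + g t) :=
  h.eqψ.mono fun t ht => by rw [← ht, Pi.add_apply, div_eq_mul_inv]

/-- The squared modulus is `f · f/(f+g) ≤ f`. -/
theorem memLp_mul_conj_series (hf : IsDensity f) (hg : IsDensity g)
    (h : IsCanonicalFactorization (f + g) ψ θ) :
    MemLp (fun t => (f t : ℂ) * conj (series ψ t)) 2 dlam := by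
  have hm := (integrable_complex_ofReal hf.integrable).1.mul (memLp_conj (memLp_series ψ)).1
  refine (memLp_two_iff_integrable_sq_norm hm).2 (hf.integrable.mono' (hm.norm.pow 2) ?_)
  filter_upwards [h.mul_norm_sq_eq, hf.div_add_le_one hg, hf.nonneg] with t h1 h2 h3
  simp only [Pi.zero_apply] at h3
  simp only [norm_pow, norm_norm, norm_mul, Complex.norm_real, Pi.mul_apply, RCLike.norm_conj,
    Real.norm_of_nonneg h3]
  rw [mul_pow, sq (f t), mul_assoc, h1]
  exact mul_le_of_le_one_right h3 h2.2

theorem memLp_series_mul_series (hf : IsDensity f) (hg : IsDensity g)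
    (h : IsCanonicalFactorization (f + g) ψ θ) (hφ : IsOneSidedFactorization f φ) :
    MemLp (fun t => series ψ t * series φ t) 2 dlam := by
  refine MemLp.of_bound ((memLp_series ψ).1.mul (memLp_series φ).1) 1 ?_
  filter_upwards [h.mul_norm_sq_eq, hf.div_add_le_one hg, hφ.eq] with t h1 h2 h3
  rw [← sq_le_one_iff₀ (norm_nonneg _), norm_mul, mul_pow, ← h3, mul_comm, h1]
  exact h2.2

/-! ### The vectors of the solution -/

variable {a : ℕ → ℂ}

/-- The moments of nonnegative order of `f A`. -/
theorem mulVecInf_conjMat_fourierMat (hf : Integrable f dlam) (ha : Summable fun k => ‖a k‖)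
    (k : ℕ) : HasSum (fun j : ℕ => a j * moment (fun t => (f t : ℂ)) ((k : ℤ) - j))
        (mulVecInf (conjMat (fourierMat f)) a k) ∧
      mulVecInf (conjMat (fourierMat f)) a k = moment (fun t => (f t : ℂ) * series a t) k := by
  have h := hasSum_mul_moment_of_summable_norm ha (integrable_mul_fourier (integrable_complex_ofReal hf) k)
  simp only [moment_mul_fourier, ← sub_eq_add_neg] at h
  have e : mulVecInf (conjMat (fourierMat f)) a k =
      ∫ t, series a t * ((f t : ℂ) * fourier k t) ∂dlam := by
    rw [← h.tsum_eq, mulVecInf]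
    simp only [conjMat_fourierMat, mul_comm (a _)]
  refine ⟨e ▸ h, e.trans ?_⟩
  simp only [moment, mul_comm (f _ : ℂ), mul_assoc]

theorem mulVecInf_conjMat_div_add (hf : IsDensity f) (hg : IsDensity g)
    (h : IsCanonicalFactorization (f + g) ψ θ) (ha : Summable fun k => ‖a k‖) (k : ℕ) :
    mulVecInf (conjMat (fourierMat fun t => f t / (f t + g t))) (mulVecInf (lowerMat θ) a) k =
      moment (fun t => (f t : ℂ) * conj (series ψ t) * series a t) k := by
  obtain ⟨hy, hy'⟩ := series_mulVecInf_lowerMat h.memθ (memℓp_two_of_summable_norm ha)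
    (memLp_mul_series_of_summable_norm (memLp_series θ) ha)
  have hs := hasSum_mul_moment hy (memLp_mul_fourier (memLp_div_add hf hg) k)
  simp only [moment_mul_fourier, ← sub_eq_add_neg] at hs
  rw [mulVecInf]
  simp only [conjMat_fourierMat, mul_comm _ (mulVecInf (lowerMat θ) a _)]
  rw [hs.tsum_eq]
  refine integral_congr_ae ?_
  filter_upwards [hy', h.mul_norm_sq_eq, h.recip] with t h1 h2 h3
  rw [h1, ← h2]
  push_cast
  rw [← Complex.mul_conj']
  linear_combination (f t : ℂ) * conj (series ψ t) * series a t * fourier k t * h3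

theorem mulVecInf_mulInf_conjTranspose (hf : IsDensity f) (hg : IsDensity g)
    (h : IsCanonicalFactorization (f + g) ψ θ) (hφ : IsOneSidedFactorization f φ)
    (ha : Summable fun k => ‖a k‖) (k : ℕ) :
    mulVecInf (mulInf (lowerMat ψ) (lowerMat φ))ᴴ (mulVecInf (lowerMat φ) a) k =
      moment (fun t => (f t : ℂ) * conj (series ψ t) * series a t) k := by
  obtain ⟨hχ, hχ'⟩ := series_mulVecInf_lowerMat h.memψ hφ.mem (memLp_series_mul_series hf hg h hφ)
  obtain ⟨hy, hy'⟩ := series_mulVecInf_lowerMat hφ.mem (memℓp_two_of_summable_norm ha)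
    (memLp_mul_series_of_summable_norm (memLp_series φ) ha)
  rw [mulInf_lowerMat, mulVecInf_lowerMat_conjTranspose hχ hy]
  refine moment_congr ?_ _
  filter_upwards [hχ', hy', hφ.eq] with t h1 h2 h3
  rw [h1, h2, h3]
  push_cast
  rw [← Complex.mul_conj', map_mul]
  ring

/-- The difference of `f A` and the series of `c` has no moments of nonnegative order, but is only
known to be integrable, so it cannot be multiplied by `conj ψ` term by term. After conjugation
`moment_mul_series_eq_zero` applies, the product being a difference of two integrable functions. -/
theorem mulVecInf_lowerMat_conjTranspose_eq (hf : IsDensity f) (hg : IsDensity g)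
    (h : IsCanonicalFactorization (f + g) ψ θ) (ha : Summable fun k => ‖a k‖)
    (hc : Memℓp (mulVecInf (conjMat (fourierMat f)) a) 2) (k : ℕ) :
    mulVecInf (lowerMat ψ)ᴴ (mulVecInf (conjMat (fourierMat f)) a) k =
      moment (fun t => (f t : ℂ) * conj (series ψ t) * series a t) k := by
  set c := mulVecInf (conjMat (fourierMat f)) a with hcdef
  rw [mulVecInf_lowerMat_conjTranspose h.memψ hc]
  have hfa := integrable_mul_series_of_summable_norm (integrable_complex_ofReal hf.integrable) ha
  have hb : Integrable (fun t => (f t : ℂ) * conj (series ψ t) * series a t) dlam :=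
    (memLp_mul_series_of_summable_norm (memLp_mul_conj_series hf hg h) ha).integrable
      (by norm_num)
  have hcψ : Integrable (fun t => series c t * conj (series ψ t)) dlam :=
    (memLp_series c).integrable_mul (memLp_conj (memLp_series ψ))
  have hv : Integrable (fun t => conj ((f t : ℂ) * series a t - series c t)) dlam :=
    (Complex.conjCLE.toContinuousLinearMap.integrable_comp (hfa.sub (integrable_series c)))
  have hv0 : ∀ n : ℤ, n ≤ 0 →
      moment (fun t => conj ((f t : ℂ) * series a t - series c t)) n = 0 := fun n hn => by
    rw [moment_conj, moment_sub hfa (integrable_series c), show -n = (n.natAbs : ℤ) by omega,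
      moment_series hc, ← (mulVecInf_conjMat_fourierMat hf.integrable ha _).2, sub_self, map_zero]
  have e : (fun t => conj ((f t : ℂ) * series a t - series c t) * series ψ t) = fun t =>
      conj ((f t : ℂ) * conj (series ψ t) * series a t - series c t * conj (series ψ t)) := by
    ext t
    simp only [map_sub, map_mul, Complex.conj_conj]
    ring
  have := moment_mul_series_eq_zero hv hv0 h.memψ
    (e ▸ Complex.conjCLE.toContinuousLinearMap.integrable_comp (hb.sub hcψ)) (n := -(k : ℤ))
    (by omega)
  rw [e, moment_conj, neg_neg, moment_sub hb hcψ, map_eq_zero, sub_eq_zero] at this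
  exact this.symm

end

/-! ### Stationary sequences -/

section

variable {Ω : Type*} [MeasurableSpace Ω] {P : Measure Ω} {ξ η : ℤ → Lp ℂ 2 P} {f g : Circ → ℝ}

theorem inner_eq_integral (X Y : Lp ℂ 2 P) : inner ℂ X Y = ∫ ω, Y ω * conj (X ω) ∂P := by
  simp only [L2.inner_def, RCLike.inner_apply]

theorem IsStationary.inner_eq (h : IsStationary P ξ f) (m n : ℤ) :
    inner ℂ (ξ m) (ξ n) = moment (fun t => (f t : ℂ)) (n - m) := by
  rw [inner_eq_integral, h.cov]
  simp only [moment, mul_comm]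

theorem inner_add_eq (hξ : IsStationary P ξ f) (h : Uncorrelated P ξ η) (m n : ℤ) :
    inner ℂ ((ξ + η) m) (ξ n) = moment (fun t => (f t : ℂ)) (n - m) := by
  rw [Pi.add_apply, inner_add_left, hξ.inner_eq, inner_eq_integral (η m), h, add_zero]

theorem inner_add_add_eq (hξ : IsStationary P ξ f) (hη : IsStationary P η g)
    (h : Uncorrelated P ξ η) (m n : ℤ) :
    inner ℂ ((ξ + η) m) ((ξ + η) n) = moment (fun t => ((f + g) t : ℂ)) (n - m) := by
  have h0 : inner ℂ (ξ m) (η n) = 0 := inner_eq_zero_symm.1 (by rw [inner_eq_integral, h])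
  rw [Pi.add_apply (i := n), inner_add_right, inner_add_eq hξ h, Pi.add_apply, inner_add_left, h0,
    hη.inner_eq, zero_add]
  simp only [moment, Pi.add_apply, Complex.ofReal_add, add_mul]
  exact (integral_add (integrable_mul_fourier (integrable_complex_ofReal hξ.density.integrable) _)
    (integrable_mul_fourier (integrable_complex_ofReal hη.density.integrable) _)).symm

variable {a : ℕ → ℂ}

theorem IsStationary.hasSum_functional (h : IsStationary P ξ f) (ha : Summable fun k => ‖a k‖) :
    HasSum (fun k : ℕ => a k • ξ (-(k : ℤ))) (functional a ξ) := by
  have hn : ∀ n, ‖ξ n‖ = ‖ξ 0‖ := fun n => by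
    rw [@norm_eq_sqrt_re_inner ℂ, @norm_eq_sqrt_re_inner ℂ _ _ _ _ (ξ 0), h.inner_eq, h.inner_eq,
      sub_self, sub_self]
  refine (Summable.of_norm ?_).hasSum
  simpa only [norm_smul, hn] using ha.mul_right ‖ξ 0‖

/-- Used with `ζ = ξ + η` for the normal equations and with `ζ = ξ` for the variance of `Aξ`. -/
theorem inner_functional_eq {ζ : ℤ → Lp ℂ 2 P} (hξ : IsStationary P ξ f)
    (ha : Summable fun k => ‖a k‖)
    (hζ : ∀ m n, inner ℂ (ζ m) (ξ n) = moment (fun t => (f t : ℂ)) (n - m)) (k : ℕ) :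
    inner ℂ (ζ (-(k : ℤ))) (functional a ξ) = mulVecInf (conjMat (fourierMat f)) a k := by
  have h := (hξ.hasSum_functional ha).mapL (innerSL ℂ (ζ (-(k : ℤ))))
  simp only [innerSL_apply_apply, inner_smul_right, hζ, neg_sub_neg] at h
  exact h.unique (mulVecInf_conjMat_fourierMat hξ.density.integrable ha k).1

theorem norm_functional_sq_eq_pairing (hξ : IsStationary P ξ f) (ha : Summable fun k => ‖a k‖) :
    ((‖functional a ξ‖ ^ 2 : ℝ) : ℂ) = pairing (mulVecInf (conjMat (fourierMat f)) a) a := by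
  have h := ((hξ.hasSum_functional ha).mapL (innerSL ℂ (functional a ξ))).star
  simp only [innerSL_apply_apply, inner_smul_right, ← starRingEnd_apply, map_mul,
    inner_conj_symm, inner_functional_eq hξ ha hξ.inner_eq] at h
  rw [pairing]
  simp only [mul_comm _ (conj _)]
  rw [h.tsum_eq, inner_self_eq_norm_sq_to_K]
  simp

end

end Filtering

/-! ### Solution of the filtering problem -/

theorem mainTheorem5 {Ω : Type*} [MeasurableSpace Ω] (P : Measure Ω) [IsProbabilityMeasure P]
    (ξ η : ℤ → Lp ℂ 2 P) (f g : Filtering.Circ → ℝ) (a ψ θ φ : ℕ → ℂ)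
    (hξ : Filtering.IsStationary P ξ f) (hη : Filtering.IsStationary P η g)
    (hξη : Filtering.Uncorrelated P ξ η)
    (hmin : Filtering.Minimality (f + g))
    (hfac : Filtering.IsCanonicalFactorization (f + g) ψ θ)
    (hfacf : Filtering.IsOneSidedFactorization f φ)
    (ha1 : Summable fun k => ‖a k‖)
    (ha2 : Summable fun k : ℕ => ((k : ℝ) + 1) * ‖a k‖ ^ 2)
    (Ahat : Lp ℂ 2 P)
    (hA : Filtering.IsOptimalEstimate (ξ + η) (Filtering.functional a ξ) Ahat) :
    -- `G`, `T`: matrices of the Fourier coefficients of `f` and `f / (f + g)`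
    let G := Filtering.fourierMat f
    let T := Filtering.fourierMat (fun t => f t / (f t + g t))
    let Ψ := Filtering.lowerMat ψ
    let Θ := Filtering.lowerMat θ
    let Φ := Filtering.lowerMat φ
    let c := Filtering.mulVecInf (Filtering.conjMat G) a
    let Cψ := Filtering.mulVecInf (Filtering.hankelMat c) (fun k => conj (ψ k))
    let z := Filtering.mulVecInf (Filtering.conjMat T) (Filtering.mulVecInf Θ a)
    -- the spectral characteristic and the error through `z`, the vector `conj(T) Θ a`
    (Memℓp z 2 ∧
      (∀ h : Filtering.Circ → ℂ,
        Filtering.IsSpectralIntegral (f + g) (ξ + η) h Ahat ↔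
          h =ᵐ[Filtering.dlam] fun t => Filtering.series ψ t * Filtering.series z t) ∧
      ((Filtering.meanSquareError (Filtering.functional a ξ) Ahat : ℝ) : ℂ) =
        Filtering.pairing c a - Filtering.pairing z z) ∧
    -- the same vector through the factorization of `G`
    z = Filtering.mulVecInf (Filtering.mulInf Ψ Φ)ᴴ (Filtering.mulVecInf Φ a) ∧
    -- the spectral characteristic and the error through `C conj(ψ)`
    (Memℓp c 2 →
      (∀ m, Summable fun j => c (m + j) * conj (ψ j)) ∧
      Cψ = Filtering.mulVecInf Ψᴴ c ∧
      Cψ = z ∧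
      Memℓp Cψ 2 ∧
      (∀ h : Filtering.Circ → ℂ,
        Filtering.IsSpectralIntegral (f + g) (ξ + η) h Ahat ↔
          h =ᵐ[Filtering.dlam] fun t => Filtering.series ψ t * Filtering.series Cψ t) ∧
      ((Filtering.meanSquareError (Filtering.functional a ξ) Ahat : ℝ) : ℂ) =
        Filtering.pairing c a - Filtering.pairing Cψ Cψ) := by
  intro G T Ψ Θ Φ c Cψ z
  have hf := hξ.density
  have hg := hη.density
  set b : Filtering.Circ → ℂ :=
    fun t => (f t : ℂ) * conj (Filtering.series ψ t) * Filtering.series a t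
  have hb : MemLp b 2 Filtering.dlam :=
    Filtering.memLp_mul_series_of_summable_norm (Filtering.memLp_mul_conj_series hf hg hfac) ha1
  have hzb : ∀ k : ℕ, z k = Filtering.moment b k :=
    Filtering.mulVecInf_conjMat_div_add hf hg hfac ha1
  have hz : Memℓp z 2 := by
    rw [show z = fun k : ℕ => Filtering.moment b k from funext hzb]
    exact Filtering.memℓp_moment hb
  have hθ := Filtering.memLp_series θ
  have hζ : ∀ m n, inner ℂ ((ξ + η) m) ((ξ + η) n) =
      inner ℂ (Filtering.shift hθ m) (Filtering.shift hθ n) := fun m n => by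
    rw [Filtering.inner_add_add_eq hξ hη hξη, Filtering.inner_shift, sub_eq_add_neg,
      ← Filtering.moment_mul_fourier]
    refine Filtering.moment_congr ?_ _
    filter_upwards [hfac.eq_norm_sq, Filtering.coeFn_shift hθ n] with t h1 h2
    rw [h1, h2]
    push_cast
    rw [← Complex.mul_conj']
    ring
  have hX : ∀ k : ℕ, inner ℂ ((ξ + η) (-(k : ℤ))) (Filtering.functional a ξ) =
      inner ℂ (Filtering.shift hθ (-(k : ℤ))) (Filtering.series z) := fun k => by
    rw [Filtering.inner_functional_eq hξ ha1 (Filtering.inner_add_eq hξ hξη),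
      Filtering.inner_shift, neg_neg,
      (Filtering.mulVecInf_conjMat_fourierMat hf.integrable ha1 k).2]
    -- The two expansions use only moments of order `k + j ≥ 0`, where `b` and the series of `z`
    -- agree; then `conj(ψ θ) = 1` turns `b · conj θ` into `f A`.
    have h1 := Filtering.hasSum_moment_mul_conj_series hfac.memθ hb k
    have h2 := Filtering.hasSum_moment_mul_conj_series hfac.memθ (Filtering.memLp_series z) k
    simp only [← Nat.cast_add, Filtering.moment_series hz, hzb] at h1 h2
    rw [h2.unique h1]
    refine Filtering.moment_congr ?_ _
    filter_upwards [hfac.recip] with t ht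
    have := congrArg conj ht
    rw [map_mul, map_one] at this
    linear_combination (-(f t : ℂ) * Filtering.series a t) * this
  obtain ⟨⟨p, hpz, hpA⟩, herr⟩ := hA.exists_tendsto hθ hζ
    (Filtering.series_mem_shiftSpan hfac.memψ hfac.memθ hfac.recip hz) hX
  have hspec : ∀ h : Filtering.Circ → ℂ, Filtering.IsSpectralIntegral (f + g) (ξ + η) h Ahat ↔
      h =ᵐ[Filtering.dlam] fun t => Filtering.series ψ t * Filtering.series z t := fun h => by
    rw [Filtering.isSpectralIntegral_iff_of_tendsto hθ hfac.eq_norm_sq hfac.series_ne_zero hζ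
      hpz hpA]
    constructor <;> intro hh <;> filter_upwards [hh, hfac.recip] with t h1 h2
    · rw [← h1]
      linear_combination (-h t) * h2
    · rw [h1]
      linear_combination Filtering.series z t * h2
  have hmse : ((Filtering.meanSquareError (Filtering.functional a ξ) Ahat : ℝ) : ℂ) =
      Filtering.pairing c a - Filtering.pairing z z := by
    rw [Filtering.meanSquareError, ← Filtering.norm_sq_eq_integral, herr, Complex.ofReal_sub,
      Filtering.norm_functional_sq_eq_pairing hξ ha1, Filtering.norm_series_sq_eq_pairing hz]
  refine ⟨⟨hz, hspec, hmse⟩, ?_, fun hc => ?_⟩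
  · ext k
    rw [hzb]
    exact (Filtering.mulVecInf_mulInf_conjTranspose hf hg hfac hfacf ha1 k).symm
  · have hCΨ : Cψ = Filtering.mulVecInf Ψᴴ c := funext fun k =>
      (Filtering.mulVecInf_lowerMat_conjTranspose_apply ψ c k).symm
    have hCz : Cψ = z := by
      rw [hCΨ]
      ext k
      rw [hzb]
      exact Filtering.mulVecInf_lowerMat_conjTranspose_eq hf hg hfac ha1 hc k
    refine ⟨fun m => ?_, hCΨ, hCz, hCz ▸ hz, hCz ▸ hspec, hCz ▸ hmse⟩
    -- Each term is dominated through `|xy| ≤ |x|² + |y|²`.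
    refine Summable.of_norm_bounded (((Filtering.memℓp_two_iff.1 hc).comp_injective
      (add_right_injective m)).add (Filtering.memℓp_two_iff.1 hfac.memψ)) fun j => ?_
    rw [norm_mul, RCLike.norm_conj, Function.comp_apply]
    nlinarith [two_mul_le_add_sq ‖c (m + j)‖ ‖ψ j‖, sq_nonneg ‖c (m + j)‖, sq_nonneg ‖ψ j‖]
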